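/- **Theorem 1.** Let $\vec\xi(j)=\{\xi_k(j)\}_{k=1}^T$ and $\vec\eta(j)=\{\eta_k(j)\}_{k=1}^T$, $j\in\mathbb Z$, be uncorrelated, centred, $T$-dimensional complex stationary sequences of square integrable random variables with spectral densities $F(\lambda)$, $G(\lambda)$ on $(-\pi,\pi]$ (positive semidefinite, integrable), i.e. $E\,\vec\xi(j+n)\vec\xi(j)^*=\frac1{2\pi}\int_{-\pi}^{\pi}e^{in\lambda}F(\lambda)\,d\lambda$, $E\,\vec\eta(j+n)\vec\eta(j)^*=\frac1{2\pi}\int_{-\pi}^{\pi}e^{in\lambda}G(\lambda)\,d\lambda$. Put $W=F+G$ and suppose that $W$ is invertible almost everywhere and $\int_{-\pi}^{\pi}W(\lambda)^{-1}d\lambda<\infty$ (entrywise integrability). Let $M_l\ge1$, $N_l\ge0$ be integers ($l=1,\dots,s$), $$S=\bigcup_{l=1}^s\{-(M_l+N_l),\dots,-M_l\},\quad S^+=\bigcup_{l=1}^s\{M_l,\dots,M_l+N_l\},\quad Z^S=\{1,2,\dots\}\setminus S^+,\quad U=S\cup\{0,1,2,\dots\},$$ and $\mathbb Z_-=\{-1,-2,\dots\}$.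 Let $\vec a(j)\in\mathbb C^T$ satisfy $\sum_{j\in Z^S}\sum_{k=1}^T|a_k(j)|<\infty$, put $\vec a(j)=\vec 0$ for $j\notin Z^S$, and let $$A\vec\xi=\sum_{j\in Z^S}\vec a(j)^\top\vec\xi(-j),\qquad A(e^{i\lambda})=\sum_{j\in Z^S}\vec a(j)e^{-ij\lambda}.$$ For $k,j\in U$ define $$B(k,j)=\frac1{2\pi}\int_{-\pi}^{\pi}W^{-1}e^{-i(k-j)\lambda}d\lambda,\quad R(k,j)=\frac1{2\pi}\int_{-\pi}^{\pi}FW^{-1}e^{-i(k+j)\lambda}d\lambda,\quad Q(k,j)=\frac1{2\pi}\int_{-\pi}^{\pi}FW^{-1}G\,e^{-i(k-j)\lambda}d\lambda,$$ and for $\mathbb C^T$-valued sequences $x$ on $U$ put $$(\mathbf Bx)(k)^\top=\sum_{j\in U}x(j)^\top B(k,j),\quad(\mathbf Rx)(k)^\top=\sum_{j\in U}x(j)^\top R(k,j),\quad(\mathbf Qx)(k)^\top=\sum_{j\in U}x(j)^\top Q(j,k),\quad\langle x,y\rangle=\sum_{k\in U}x(k)^\top\overline{y(k)}.$$ Since $\mathbf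 B$ need not be bounded in $\ell_2$, $\mathbf B^{-1}$ is understood as follows: $\vec{\mathbf c}=\mathbf B^{-1}\vec{\mathbf y}$ and $q=\langle\vec{\mathbf y},\mathbf B^{-1}\vec{\mathbf y}\rangle$ mean that there are finitely supported sequences $x_n$ on $U$, Cauchy for the positive definite quadratic form $\langle\mathbf Bx,x\rangle$, such that $\mathbf Bx_n\to\vec{\mathbf y}$ and $x_n\to\vec{\mathbf c}$ coordinatewise and $\langle\vec{\mathbf y},x_n\rangle\to q$. Then all the integrals and series defining $B(k,j),R(k,j),Q(k,j)$, $A\vec\xi$, $\mathbf R\vec{\mathbf a}$, $\mathbf Q\vec{\mathbf a}$ and $\langle\mathbf Q\vec{\mathbf a},\vec{\mathbf a}\rangle$ converge; $\vec{\mathbf c}=\mathbf B^{-1}\mathbf R\vec{\mathbf a}$ and $\langle\mathbf R\vec{\mathbf a},\mathbf B^{-1}\mathbf R\vec{\mathbf a}\rangle$ exist and are unique, and if $\mathbf B$ is a bounded operator in $\ell_2$ with a bounded inverse, then $\mathbf R\vec{\mathbf a}\in\ell_2$ and they are given by the ordinary inverse operator and the ordinary inner product; and there is an integrable function $C(e^{i\lambda})$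 with Fourier series $\sum_{k\in U}\vec c(k)e^{ik\lambda}$. There is exactly one mean-square optimal linear estimate $\hat A\vec\xi$ of $A\vec\xi$ from the observations $\vec\xi(j)+\vec\eta(j)$, $j\in\mathbb Z_-\setminus S$, i.e. one element of the closed linear span in $L_2$ of the variables $\xi_k(j)+\eta_k(j)$, $j\in\mathbb Z_-\setminus S$, $1\le k\le T$, with the least mean-square error. Its spectral characteristic, i.e. the function $h$ in the closed subspace of $L_2(F+G)$ generated by $e^{in\lambda}\delta_k$, $n\in\mathbb Z_-\setminus S$, such that $\hat A\vec\xi$ is the image of $h$ under the isometry of $L_2(F+G)$ that sends $e^{in\lambda}\delta_k$ to $\xi_k(n)+\eta_k(n)$ (norm $\frac1{2\pi}\int h^\top(F+G)\overline h\,d\lambda$ squared), exists, is unique almost everywhere and equals $$h(e^{i\lambda})^\top=A(e^{i\lambda})^\top F(\lambda)(F(\lambda)+G(\lambda))^{-1}-\Big(\sum_{k\in U}(\mathbf B^{-1}\mathbf R\vec{\mathbf a})(k)e^{ik\lambda}\Big)^\top(F(\lambda)+G(\lambda))^{-1},\tag{4}$$ where the sum denotes $C(e^{i\lambda})$. The mean-square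 error is $$E|A\vec\xi-\hat A\vec\xi|^2=\frac1{2\pi}\int_{-\pi}^{\pi}r_G^\top F\,\overline{r_G}\,d\lambda+\frac1{2\pi}\int_{-\pi}^{\pi}r_F^\top G\,\overline{r_F}\,d\lambda=\langle\mathbf R\vec{\mathbf a},\mathbf B^{-1}\mathbf R\vec{\mathbf a}\rangle+\langle\mathbf Q\vec{\mathbf a},\vec{\mathbf a}\rangle,$$ where $r_F^\top=(A^\top F-C^\top)(F+G)^{-1}$ and $r_G^\top=(A^\top G+C^\top)(F+G)^{-1}$. -/

import Mathlib

open MeasureTheory Filter Topology Matrix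
open scoped ENNReal ComplexOrder

namespace Filtering

/-! ### Index sets -/

/-- The missing instants `S = ⋃ l, {-(M l + N l), …, -(M l)}`. -/
def missing {s : ℕ} (M N : Fin s → ℕ) : Set ℤ :=
  {j | ∃ l, -((M l : ℤ) + N l) ≤ j ∧ j ≤ -(M l : ℤ)}

/-- The reflected set `S⁺ = ⋃ l, {M l, …, M l + N l}`. -/
def missingPlus {s : ℕ} (M N : Fin s → ℕ) : Set ℤ :=
  {j | ∃ l, (M l : ℤ) ≤ j ∧ j ≤ (M l : ℤ) + N l}

/-- The instants of observation `ℤ₋ \ S`, where `ℤ₋ = {-1, -2, …}`. -/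
def observed {s : ℕ} (M N : Fin s → ℕ) : Set ℤ :=
  {j | j < 0} \ missing M N

/-- `Z^S = {1, 2, …} \ S⁺`. -/
def target {s : ℕ} (M N : Fin s → ℕ) : Set ℤ :=
  {j | 1 ≤ j} \ missingPlus M N

/-- `U = S ∪ {0, 1, 2, …}`. -/
def unobserved {s : ℕ} (M N : Fin s → ℕ) : Set ℤ :=
  missing M N ∪ {j | 0 ≤ j}

/-! ### Functions on the circle, represented on `(-π, π]` -/

/-- Lebesgue measure on `(-π, π]`. -/
noncomputable def circleMeasure : Measure ℝ :=
  volume.restrict (Set.Ioc (-Real.pi) Real.pi)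

/-- The character `exp (i n t)`. -/
noncomputable def char (n : ℤ) (t : ℝ) : ℂ :=
  Complex.exp (Complex.I * n * t)

/-- `n`-th Fourier coefficient `(1 / 2π) ∫ φ(t) exp (-i n t) dt`. -/
noncomputable def fourierCoef (φ : ℝ → ℂ) (n : ℤ) : ℂ :=
  (2 * Real.pi : ℂ)⁻¹ * ∫ t, char (-n) t * φ t ∂circleMeasure

/-- Entrywise Fourier coefficient of a matrix function. -/
noncomputable def matFourierCoef {T : ℕ} (Φ : ℝ → Matrix (Fin T) (Fin T) ℂ) (n : ℤ) :
    Matrix (Fin T) (Fin T) ℂ :=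
  Matrix.of fun p q => fourierCoef (fun t => Φ t p q) n

/-- All entries of the matrix function are integrable over `(-π, π]`. -/
def MatIntegrable {T : ℕ} (Φ : ℝ → Matrix (Fin T) (Fin T) ℂ) : Prop :=
  ∀ p q, Integrable (fun t => Φ t p q) circleMeasure

/-- The squared norm `(1 / 2π) ∫ f(t)ᵀ W(t) conj f(t) dt` of `L₂(W)`, with values in `[0, ∞]`,
for a positive semidefinite weight `W`. -/
noncomputable def weightedNormSq {T : ℕ} (W : ℝ → Matrix (Fin T) (Fin T) ℂ)
    (f : ℝ → Fin T → ℂ) : ℝ≥0∞ :=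
  ENNReal.ofReal (2 * Real.pi)⁻¹ *
    ∫⁻ t, ENNReal.ofReal (f t ⬝ᵥ (W t *ᵥ star (f t))).re ∂circleMeasure

/-- Membership in `L₂(W)`. -/
def MemWeighted {T : ℕ} (W : ℝ → Matrix (Fin T) (Fin T) ℂ) (f : ℝ → Fin T → ℂ) : Prop :=
  (∀ p, AEStronglyMeasurable (fun t => f t p) circleMeasure) ∧ weightedNormSq W f < ∞

/-- The trigonometric polynomial `∑ n, x(n) exp (i n t)` with vector coefficients. -/
noncomputable def trigPoly {T : ℕ} (x : ℤ →₀ (Fin T → ℂ)) (t : ℝ) : Fin T → ℂ :=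
  x.sum fun n v => char n t • v

/-- `C` is integrable and has the Fourier series `∑_{k ∈ U} c(k) exp (i k t)`. -/
def HasFourierSeriesOn {T : ℕ} (U : Set ℤ) (c : U → Fin T → ℂ) (C : ℝ → Fin T → ℂ) : Prop :=
  (∀ p, Integrable (fun t => C t p) circleMeasure) ∧
  (∀ (k : U) (p : Fin T), fourierCoef (fun t => C t p) k = c k p) ∧
  (∀ k : ℤ, k ∉ U → ∀ p : Fin T, fourierCoef (fun t => C t p) k = 0)

/-! ### Stationary sequences in `L₂(Ω, P)` -/

section Probability

variable {Ω : Type*} [MeasurableSpace Ω]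

/-- `E X conj Y`. -/
noncomputable def covariance (P : Measure Ω) (X Y : Lp ℂ 2 P) : ℂ :=
  ∫ ω, X ω * star (Y ω) ∂P

/-- `ξ` is a centred `T`-dimensional stationary sequence with spectral density `F`:
`E ξ(j+n) ξ(j)^* = (1 / 2π) ∫ exp (i n t) F(t) dt` for all `j` and `n`. -/
structure IsStationaryWithDensity {T : ℕ} (P : Measure Ω) (ξ : ℤ → Fin T → Lp ℂ 2 P)
    (F : ℝ → Matrix (Fin T) (Fin T) ℂ) : Prop where
  mean_zero : ∀ j p, ∫ ω, ξ j p ω ∂P = 0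
  posSemidef : ∀ᵐ t ∂circleMeasure, (F t).PosSemidef
  integrable : MatIntegrable F
  correlation : ∀ (j n : ℤ) (p q : Fin T),
    covariance P (ξ (j + n) p) (ξ j q) =
      (2 * Real.pi : ℂ)⁻¹ * ∫ t, char n t * F t p q ∂circleMeasure

/-- Uncorrelated sequences. -/
def Uncorrelated {T : ℕ} (P : Measure Ω) (ξ η : ℤ → Fin T → Lp ℂ 2 P) : Prop :=
  ∀ i j p q, covariance P (ξ i p) (η j q) = 0

/-- The mean-square error `E |X - Y|²`. -/
noncomputable def meanSquareError (P : Measure Ω) (X Y : Lp ℂ 2 P) : ℝ :=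
  ∫ ω, ‖X ω - Y ω‖ ^ 2 ∂P

/-- The closed linear span of the components `ζ_k(j)`, `j ∈ O`. -/
noncomputable def observationSpace {T : ℕ} (P : Measure Ω) (ζ : ℤ → Fin T → Lp ℂ 2 P)
    (O : Set ℤ) : Submodule ℂ (Lp ℂ 2 P) :=
  (Submodule.span ℂ {X | ∃ j ∈ O, ∃ k, X = ζ j k}).topologicalClosure

/-- `Y` is a mean-square optimal linear estimate of `X` from the observations `ζ(j)`, `j ∈ O`. -/
def IsOptimalEstimate {T : ℕ} (P : Measure Ω) (ζ : ℤ → Fin T → Lp ℂ 2 P) (O : Set ℤ)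
    (X Y : Lp ℂ 2 P) : Prop :=
  Y ∈ observationSpace P ζ O ∧
    ∀ Z ∈ observationSpace P ζ O, meanSquareError P X Y ≤ meanSquareError P X Z

/-- The finite linear combination `∑ n, x(n)ᵀ ζ(n)`, that is, the stochastic integral of the
trigonometric polynomial with coefficients `x` against the spectral stochastic measure of `ζ`. -/
noncomputable def linComb {T : ℕ} (P : Measure Ω) (ζ : ℤ → Fin T → Lp ℂ 2 P)
    (x : ℤ →₀ (Fin T → ℂ)) : Lp ℂ 2 P :=
  x.sum fun n v => ∑ k, v k • ζ n k

/-- `h` is the spectral characteristic of the linear estimate `Y` from the observations `ζ(j)`,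
`j ∈ O`, where `ζ` has spectral density `W`: `h` belongs to the closed subspace of `L₂(W)`
generated by the functions `exp (i n t) δ_k`, `n ∈ O`, and `Y = ∫ hᵀ dZ_ζ`. The stochastic
integral is the extension by continuity (an isometry on `L₂(W)`) of its values on trigonometric
polynomials. -/
def IsSpectralCharacteristic {T : ℕ} (P : Measure Ω) (ζ : ℤ → Fin T → Lp ℂ 2 P)
    (W : ℝ → Matrix (Fin T) (Fin T) ℂ) (O : Set ℤ) (h : ℝ → Fin T → ℂ) (Y : Lp ℂ 2 P) : Prop :=
  MemWeighted W h ∧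
  ∃ x : ℕ → (ℤ →₀ (Fin T → ℂ)),
    (∀ n, ((x n).support : Set ℤ) ⊆ O) ∧
    Tendsto (fun n => weightedNormSq W (fun t => trigPoly (x n) t - h t)) atTop (𝓝 0) ∧
    Tendsto (fun n => linComb P ζ (x n)) atTop (𝓝 Y)

/-- The functional `A ξ = ∑_{j ∈ Z} a(j)ᵀ ξ(-j)`. -/
noncomputable def linFunctional {T : ℕ} (P : Measure Ω) (ξ : ℤ → Fin T → Lp ℂ 2 P)
    (Z : Set ℤ) (a : ℤ → Fin T → ℂ) : Lp ℂ 2 P :=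
  ∑' j : Z, ∑ k, a j k • ξ (-(j : ℤ)) k

end Probability

/-! ### The minimality condition, the block matrices and their action -/

/-- `W` is invertible almost everywhere and `∫ W⁻¹ < ∞`. -/
def Minimality {T : ℕ} (W : ℝ → Matrix (Fin T) (Fin T) ℂ) : Prop :=
  (∀ᵐ t ∂circleMeasure, IsUnit (W t)) ∧ MatIntegrable (fun t => (W t)⁻¹)

/-- `A(e^{it}) = ∑_{j ∈ Z} a(j) exp (-i j t)`. -/
noncomputable def functionalSymbol {T : ℕ} (Z : Set ℤ) (a : ℤ → Fin T → ℂ) (t : ℝ) :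
    Fin T → ℂ :=
  ∑' j : Z, char (-(j : ℤ)) t • a j

/-- `B(k,j) = (1 / 2π) ∫ (F+G)⁻¹ exp (-i(k-j)t) dt`. -/
noncomputable def blockB {T : ℕ} (F G : ℝ → Matrix (Fin T) (Fin T) ℂ) (k j : ℤ) :
    Matrix (Fin T) (Fin T) ℂ :=
  matFourierCoef (fun t => (F t + G t)⁻¹) (k - j)

/-- `R(k,j) = (1 / 2π) ∫ F (F+G)⁻¹ exp (-i(k+j)t) dt`. -/
noncomputable def blockR {T : ℕ} (F G : ℝ → Matrix (Fin T) (Fin T) ℂ) (k j : ℤ) :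
    Matrix (Fin T) (Fin T) ℂ :=
  matFourierCoef (fun t => F t * (F t + G t)⁻¹) (k + j)

/-- `Q(k,j) = (1 / 2π) ∫ F (F+G)⁻¹ G exp (-i(k-j)t) dt`. -/
noncomputable def blockQ {T : ℕ} (F G : ℝ → Matrix (Fin T) (Fin T) ℂ) (k j : ℤ) :
    Matrix (Fin T) (Fin T) ℂ :=
  matFourierCoef (fun t => F t * (F t + G t)⁻¹ * G t) (k - j)

/-- `(R a)(k)ᵀ = ∑_{j ∈ U} a(j)ᵀ R(k,j)`. -/
noncomputable def applyR {T : ℕ} (F G : ℝ → Matrix (Fin T) (Fin T) ℂ) (U : Set ℤ)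
    (a : ℤ → Fin T → ℂ) (k : U) : Fin T → ℂ :=
  ∑' j : U, a j ᵥ* blockR F G k j

/-- `(Q a)(k)ᵀ = ∑_{j ∈ U} a(j)ᵀ Q(j,k)`; the order of the indices comes from the exponents
`-j` in `A(e^{it}) = ∑ a(j) exp (-i j t)`. -/
noncomputable def applyQ {T : ℕ} (F G : ℝ → Matrix (Fin T) (Fin T) ℂ) (U : Set ℤ)
    (a : ℤ → Fin T → ℂ) (k : U) : Fin T → ℂ :=
  ∑' j : U, a j ᵥ* blockQ F G j k

/-- The action `(K x)(k)ᵀ = ∑ j, x(j)ᵀ K(k,j)` of a block matrix on a finitely supported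
sequence. -/
noncomputable def applyFin {T : ℕ} {ι : Type*} (K : ι → ι → Matrix (Fin T) (Fin T) ℂ)
    (x : ι →₀ (Fin T → ℂ)) (k : ι) : Fin T → ℂ :=
  x.sum fun j v => v ᵥ* K k j

/-- `⟨y, x⟩ = ∑ k, y(k)ᵀ conj x(k)` for a finitely supported `x`. -/
noncomputable def pairFin {T : ℕ} {ι : Type*} (y : ι → Fin T → ℂ) (x : ι →₀ (Fin T → ℂ)) : ℂ :=
  x.sum fun k v => y k ⬝ᵥ star v

/-- `c = K⁻¹ y` and `q = ⟨y, K⁻¹ y⟩` for a positive definite block matrix `K`: there are finitely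
supported sequences `x n` that form a Cauchy sequence for the quadratic form `⟨K x, x⟩`, and along
which `K (x n) → y` and `x n → c` coordinatewise and `⟨y, x n⟩ → q`. In other words, `c` is the
solution of `K c = y` in the completion of the finitely supported sequences for the form of `K`.
If the matrix defines a bounded operator in `ℓ₂` with a bounded inverse, the form is equivalent
to the square of the norm of `ℓ₂`, and this is the ordinary inverse operator applied to `y`. -/
def IsInverseImage {T : ℕ} {ι : Type*} (K : ι → ι → Matrix (Fin T) (Fin T) ℂ)
    (y c : ι → Fin T → ℂ) (q : ℂ) : Prop :=
  ∃ x : ℕ → (ι →₀ (Fin T → ℂ)),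
    (∀ ε > 0, ∃ n₀, ∀ m ≥ n₀, ∀ n ≥ n₀,
      ‖pairFin (applyFin K (x m - x n)) (x m - x n)‖ < ε) ∧
    (∀ k, Tendsto (fun n => applyFin K (x n) k) atTop (𝓝 (y k))) ∧
    (∀ k, Tendsto (fun n => x n k) atTop (𝓝 (c k))) ∧
    Tendsto (fun n => pairFin y (x n)) atTop (𝓝 q)

/-- The space `ℓ₂` of square summable sequences of vectors of `ℂ^T`, indexed by `U`. -/
abbrev SeqSpace (T : ℕ) (U : Set ℤ) : Type :=
  lp (fun _ : U => EuclideanSpace ℂ (Fin T)) 2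

/-- The bounded operator `K'` in `ℓ₂` is given by the block matrix `K`:
`(K' x)(k)ᵀ = ∑_{j ∈ U} x(j)ᵀ K(k,j)`. -/
def HasBlockMatrix {T : ℕ} {U : Set ℤ} (K' : SeqSpace T U → SeqSpace T U)
    (K : U → U → Matrix (Fin T) (Fin T) ℂ) : Prop :=
  ∀ (x : SeqSpace T U) (k : U),
    HasSum (fun j : U => WithLp.ofLp (x j) ᵥ* K k j) (WithLp.ofLp ((K' x) k))

end Filtering

/-!
The sum `ζ = ξ + η` has the spectral density `W = F + G`. Let `S` be a Hermitian square root of `W`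
and `D = S⁻¹`; both have square integrable entries, because `W` and `W⁻¹` are integrable. In the
Hilbert space of square integrable `ℂ^T`-valued functions on the circle consider the functions
`e(n, p)` and `d(n, p)`, namely `exp (i n t)` times the `p`-th row of `S` and of `D`. The Gram
matrix of `e` is that of `ζ`, so that `ζ(n, p) ↦ e(n, p)` is an isometry and `h ↦ hᵀ S` identifies
`L₂(W)` with the unweighted space; the Gram matrix of `d` is `B`; and `e`, `d` are biorthogonal.
The projection of `A ξ` on the span of `ζ` corresponds to `Γ = Aᵀ F D`, and `⟨d, Γ⟩ = R a`.

Write `Γ = θ + φ`, where `θ` is the projection of `Γ` on the closed span of `e(n, p)` for the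
observed instants `n`. Then `θ` corresponds to the optimal estimate. The heart of the matter is that
`φ`, which is orthogonal to `e(n, p)` for all observed `n`, lies in the closed span of `d(k, p)`,
`k ∈ U` (`mem_closure_of_inner_charRow_eq_zero`). Granted this, `B⁻¹ R a` consists of the
coordinates `c = ⟨e, φ⟩` of `φ`, and `⟨R a, B⁻¹ R a⟩ = ‖φ‖²` (`isInverseImage_of_mem_closure`,
`IsInverseImage.eq_of_mem_closure`, `HasBlockMatrix.symm_apply`). The function with the Fourier
coefficients `c` is `Cᵀ = φᵀ S`, and `hᵀ = θᵀ D = (Γ - φ)ᵀ D` is the formula for the spectral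
characteristic. The error is `‖A ξ‖² - ‖θ‖² = (‖A ξ‖² - ‖Γ‖²) + ‖φ‖²`, where the first term is
`⟨Q a, a⟩` because `F W⁻¹ G = F - F W⁻¹ F`.

The completeness statement amounts to the following (`eq_zero_of_inner_charRow_eq_zero`): if `φ` is
orthogonal to `e(n, p)` for `n ∉ U` and to `d(n, p)` for `n ∈ U`, then `φ = 0`. Up to finitely many
frequencies, `f = φ S` and `conj g = conj (φ D)` are integrable functions of Hardy type, and
`∑ f_p conj g_p = |φ|²` is integrable although the separate products need not be. That the integral
of such a sum is the sum of the products of the constant terms is a theorem of Smirnov type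
(`integral_sum_mul_of_fourierCoef_eq_zero`): an outer multiplier, which comes from Szegő's extremal
problem (`exists_outer`), makes all the factors bounded, and Parseval's identity applies; then the
multiplier tends to `1`.
-/

namespace Filtering

/-! ### Characters and Fourier coefficients on the circle -/

lemma char_zero (t : ℝ) : char 0 t = 1 := by simp [char]

lemma char_add (m n : ℤ) (t : ℝ) : char (m + n) t = char m t * char n t := by
  simp only [char, ← Complex.exp_add]
  push_cast
  ring_nf

lemma star_char (n : ℤ) (t : ℝ) : star (char n t) = char (-n) t := by
  simp only [char, Complex.star_def, ← Complex.exp_conj]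
  simp

lemma norm_char (n : ℤ) (t : ℝ) : ‖char n t‖ = 1 := by
  have : Complex.I * n * t = ((n * t : ℝ) : ℂ) * Complex.I := by push_cast; ring
  rw [char, this, Complex.norm_exp_ofReal_mul_I]

lemma continuous_char (n : ℤ) : Continuous (char n) := by
  unfold char; fun_prop

lemma aestronglyMeasurable_char (n : ℤ) (μ : Measure ℝ) : AEStronglyMeasurable (char n) μ :=
  (continuous_char n).aestronglyMeasurable

/-- The measure `dt / 2π` on `(-π, π]`, normalized to be a probability measure. -/
noncomputable def circleProb : Measure ℝ := ENNReal.ofReal (2 * Real.pi)⁻¹ • circleMeasure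

lemma ofReal_two_pi_inv_ne_zero : ENNReal.ofReal (2 * Real.pi)⁻¹ ≠ 0 := by
  simp [Real.pi_pos]

instance : IsProbabilityMeasure circleProb := by
  constructor
  have h : (Real.pi - -Real.pi) = 2 * Real.pi := by ring
  simp only [circleProb, circleMeasure, Measure.smul_apply, Measure.restrict_apply_univ,
    Real.volume_Ioc, smul_eq_mul, h]
  rw [← ENNReal.ofReal_mul (by positivity), inv_mul_cancel₀ (by positivity), ENNReal.ofReal_one]

lemma ae_circleProb : ae circleProb = ae circleMeasure :=
  Measure.ae_ennreal_smul_measure_eq ofReal_two_pi_inv_ne_zero _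

lemma integrable_circleProb {F : Type*} [NormedAddCommGroup F] {f : ℝ → F} :
    Integrable f circleProb ↔ Integrable f circleMeasure :=
  integrable_smul_measure ofReal_two_pi_inv_ne_zero ENNReal.ofReal_ne_top

lemma aestronglyMeasurable_circleProb {F : Type*} [TopologicalSpace F] {f : ℝ → F} :
    AEStronglyMeasurable f circleProb ↔ AEStronglyMeasurable f circleMeasure :=
  ⟨fun h => h.mono_ac (Measure.ae_le_iff_absolutelyContinuous.1 ae_circleProb.ge),
    fun h => h.mono_ac (Measure.ae_le_iff_absolutelyContinuous.1 ae_circleProb.le)⟩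

lemma integral_circleProb (f : ℝ → ℂ) :
    ∫ t, f t ∂circleProb = (2 * Real.pi : ℂ)⁻¹ * ∫ t, f t ∂circleMeasure := by
  rw [circleProb, integral_smul_measure, ENNReal.toReal_ofReal (by positivity), Complex.real_smul]
  push_cast; rfl

lemma fourierCoef_eq (φ : ℝ → ℂ) (n : ℤ) :
    fourierCoef φ n = ∫ t, char (-n) t * φ t ∂circleProb := by
  rw [integral_circleProb]; rfl

lemma integrable_char_mul {φ : ℝ → ℂ} {μ : Measure ℝ} (h : Integrable φ μ) (n : ℤ) :
    Integrable (fun t => char n t * φ t) μ :=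
  h.bdd_mul (c := 1) (aestronglyMeasurable_char n μ) (.of_forall fun t => (norm_char n t).le)

lemma integral_char (n : ℤ) : ∫ t, char n t ∂circleProb = if n = 0 then 1 else 0 := by
  split_ifs with h
  · subst h; simp [char_zero]
  · rw [integral_circleProb, circleMeasure,
      ← intervalIntegral.integral_of_le (by linarith [Real.pi_pos])]
    have hc : Complex.I * n ≠ 0 := by simp [h]
    simp only [char]
    rw [integral_exp_mul_complex hc]
    have : Complex.exp (Complex.I * n * (Real.pi : ℝ)) =
        Complex.exp (Complex.I * n * (-Real.pi : ℝ)) := by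
      rw [Complex.exp_eq_exp_iff_exists_int]
      exact ⟨n, by push_cast; ring⟩
    rw [this]; simp

lemma fourierCoef_char_mul (φ : ℝ → ℂ) (m n : ℤ) :
    fourierCoef (fun t => char m t * φ t) n = fourierCoef φ (n - m) := by
  simp only [fourierCoef_eq, ← mul_assoc, ← char_add]
  congr 1; ext t; congr 2; ring

lemma fourierCoef_char (m n : ℤ) : fourierCoef (char m) n = if n = m then 1 else 0 := by
  simp only [fourierCoef_eq, ← char_add, integral_char]
  congr 1
  simp only [eq_iff_iff]
  constructor <;> intro h <;> omega

lemma fourierCoef_congr {φ ψ : ℝ → ℂ} (h : φ =ᵐ[circleProb] ψ) (n : ℤ) :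
    fourierCoef φ n = fourierCoef ψ n := by
  simp only [fourierCoef_eq]
  exact integral_congr_ae (h.mono fun t ht => by simp [ht])

lemma fourierCoef_add {φ ψ : ℝ → ℂ} (hφ : Integrable φ circleProb) (hψ : Integrable ψ circleProb)
    (n : ℤ) : fourierCoef (fun t => φ t + ψ t) n = fourierCoef φ n + fourierCoef ψ n := by
  simp only [fourierCoef_eq, mul_add]
  exact integral_add (integrable_char_mul hφ _) (integrable_char_mul hψ _)

lemma fourierCoef_sub {φ ψ : ℝ → ℂ} (hφ : Integrable φ circleProb) (hψ : Integrable ψ circleProb)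
    (n : ℤ) : fourierCoef (fun t => φ t - ψ t) n = fourierCoef φ n - fourierCoef ψ n := by
  simp only [fourierCoef_eq, mul_sub]
  exact integral_sub (integrable_char_mul hφ _) (integrable_char_mul hψ _)

lemma fourierCoef_const_mul (φ : ℝ → ℂ) (c : ℂ) (n : ℤ) :
    fourierCoef (fun t => c * φ t) n = c * fourierCoef φ n := by
  simp only [fourierCoef_eq, mul_left_comm _ c, integral_const_mul]

lemma fourierCoef_sum {ι : Type*} (s : Finset ι) {φ : ι → ℝ → ℂ}
    (hφ : ∀ i ∈ s, Integrable (φ i) circleProb) (n : ℤ) :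
    fourierCoef (fun t => ∑ i ∈ s, φ i t) n = ∑ i ∈ s, fourierCoef (φ i) n := by
  simp only [fourierCoef_eq, Finset.mul_sum]
  exact integral_finsetSum _ fun i hi => integrable_char_mul (hφ i hi) _

lemma fourierCoef_star (φ : ℝ → ℂ) (n : ℤ) :
    fourierCoef (fun t => star (φ t)) n = star (fourierCoef φ (-n)) := by
  simp only [fourierCoef_eq, Complex.star_def]
  rw [← integral_conj]
  congr 1; ext t
  rw [map_mul, ← Complex.star_def, star_char, neg_neg]

/-- An integrable function on the circle all of whose Fourier coefficients vanish is zero. -/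
theorem ae_eq_zero_of_fourierCoef_eq_zero {φ : ℝ → ℂ} (hφ : Integrable φ circleProb)
    (h : ∀ n, fourierCoef φ n = 0) : φ =ᵐ[circleProb] 0 := by
  have : Fact (0 < 2 * Real.pi) := ⟨Real.two_pi_pos⟩
  have hbd (g : C(AddCircle (2 * Real.pi), ℂ)) :
      Integrable (fun t : ℝ => g t * φ t) circleProb :=
    hφ.bdd_mul (c := ‖g‖)
      (g.continuous.comp (AddCircle.continuous_mk' _)).aestronglyMeasurable
      (.of_forall fun t => g.norm_coe_le_norm _)
  let L : C(AddCircle (2 * Real.pi), ℂ) →L[ℂ] ℂ := LinearMap.mkContinuous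
    { toFun := fun g => ∫ t : ℝ, g t * φ t ∂circleProb
      map_add' := fun g g' => by
        simp only [ContinuousMap.add_apply, add_mul]
        exact integral_add (hbd g) (hbd g')
      map_smul' := fun c g => by
        simp only [ContinuousMap.smul_apply, smul_eq_mul, mul_assoc, integral_const_mul,
          RingHom.id_apply] }
    (∫ t, ‖φ t‖ ∂circleProb) (fun g => by
      refine (?_ : _ ≤ _).trans_eq ((integral_const_mul ‖g‖ _).trans (mul_comm _ _))
      refine norm_integral_le_of_norm_le (hφ.norm.const_mul _) (.of_forall fun t => ?_)
      rw [norm_mul]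
      gcongr
      exact g.norm_coe_le_norm _)
  have hL (g) : L g = ∫ t : ℝ, g t * φ t ∂circleProb := rfl
  have hL0 : L = 0 := by
    refine ContinuousLinearMap.ext_on (s := Set.range (@fourier (2 * Real.pi))) ?_ ?_
    · rw [dense_iff_closure_eq, ← Submodule.topologicalClosure_coe, span_fourier_closure_eq_top]
      rfl
    · rintro _ ⟨n, rfl⟩
      rw [hL, _root_.zero_apply, ← neg_neg n, ← h (-n), fourierCoef_eq]
      congr 1; ext t
      rw [fourier_coe_apply, char]
      congr 2
      have : (Real.pi : ℂ) ≠ 0 := by exact_mod_cast Real.pi_ne_zero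
      push_cast
      field_simp
  have key := isOpen_Ioo (a := -Real.pi) (b := Real.pi)
    |>.ae_eq_zero_of_integral_contDiff_smul_eq_zero (μ := circleProb)
    (hφ.locallyIntegrable.locallyIntegrableOn _) (fun g hg hgc hgs => by
      have hz (x : ℝ) (hx : x ∉ Set.Ioo (-Real.pi) Real.pi) : g x = 0 :=
        image_eq_zero_of_notMem_tsupport fun hx' => hx (hgs hx')
      let f : ℝ → ℂ := fun x => (g x : ℂ)
      have hfc : Continuous f := Complex.continuous_ofReal.comp hg.continuous
      have hper : f (-Real.pi) = f (-Real.pi + 2 * Real.pi) := by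
        simp only [f]
        rw [hz _ (by simp), hz _ (by simp; intro; linarith)]
      have := congrArg (fun L => L (⟨AddCircle.liftIoc (2 * Real.pi) (-Real.pi) f,
        AddCircle.liftIoc_continuous hper hfc.continuousOn⟩ : C(AddCircle (2 * Real.pi), ℂ))) hL0
      simp only [hL, _root_.zero_apply, ContinuousMap.coe_mk] at this
      rw [← this]
      refine integral_congr_ae ?_
      rw [EventuallyEq, ae_circleProb, circleMeasure]
      filter_upwards [ae_restrict_mem measurableSet_Ioc] with t ht
      rw [AddCircle.liftIoc_coe_apply (by convert! ht using 2; ring)]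
      simp [f])
  have hne : ∀ᵐ t ∂circleProb, t ≠ Real.pi := by
    rw [ae_circleProb, circleMeasure]
    exact ae_restrict_of_ae (by simp [ae_iff, Set.ofPred_eq_eq_singleton] )
  have hmem : ∀ᵐ t ∂circleProb, t ∈ Set.Ioc (-Real.pi) Real.pi := by
    rw [ae_circleProb, circleMeasure]
    exact ae_restrict_mem measurableSet_Ioc
  filter_upwards [key, hne, hmem] with t h1 h2 h3
  exact h1 ⟨h3.1, lt_of_le_of_ne h3.2 h2⟩

lemma norm_sq_eq_integral {α E : Type*} [MeasurableSpace α] {μ : Measure α}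
    [NormedAddCommGroup E] [InnerProductSpace ℂ E] (φ : Lp E 2 μ) :
    ‖φ‖ ^ 2 = ∫ t, ‖φ t‖ ^ 2 ∂μ := by
  rw [← inner_self_eq_norm_sq (𝕜 := ℂ) φ, L2.inner_def, ← integral_re (L2.integrable_inner φ φ)]
  congr 1; ext t; rw [inner_self_eq_norm_sq]

/-- The character `exp (i n t)` as an element of `L²`. -/
noncomputable def charL2 (n : ℤ) : Lp ℂ 2 circleProb :=
  (MemLp.of_bound (aestronglyMeasurable_char n _) 1
    (.of_forall fun t => (norm_char n t).le)).toLp (char n)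

lemma coeFn_charL2 (n : ℤ) : charL2 n =ᵐ[circleProb] char n := MemLp.coeFn_toLp _

lemma inner_charL2 (n : ℤ) (f : Lp ℂ 2 circleProb) :
    inner ℂ (charL2 n) f = fourierCoef f n := by
  rw [L2.inner_def, fourierCoef_eq]
  refine integral_congr_ae ?_
  filter_upwards [coeFn_charL2 n] with t ht
  rw [ht, RCLike.inner_apply, ← Complex.star_def, star_char, mul_comm]

lemma orthonormal_charL2 : Orthonormal ℂ charL2 := by
  classical
  rw [orthonormal_iff_ite]
  intro i j
  rw [inner_charL2, fourierCoef_congr (coeFn_charL2 j), fourierCoef_char]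

/-- The characters form a Hilbert basis of `L²` of the circle. -/
noncomputable def charBasis : HilbertBasis ℤ ℂ (Lp ℂ 2 circleProb) :=
  HilbertBasis.mkOfOrthogonalEqBot orthonormal_charL2 <| by
    rw [eq_bot_iff]
    intro f hf
    rw [Submodule.mem_bot]
    refine (Lp.eq_zero_iff_ae_eq_zero).2 <| ae_eq_zero_of_fourierCoef_eq_zero
      ((Lp.memLp f).integrable one_le_two) fun n => ?_
    rw [← inner_charL2]
    exact hf _ (Submodule.subset_span ⟨n, rfl⟩)

/-- The integral of a product of two square integrable functions of Hardy type is the product of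
their constant Fourier coefficients. -/
theorem integral_mul_of_fourierCoef_eq_zero {a b : ℝ → ℂ} (ha : MemLp a 2 circleProb)
    (hb : MemLp b 2 circleProb) (ha0 : ∀ n < 0, fourierCoef a n = 0)
    (hb0 : ∀ n < 0, fourierCoef b n = 0) :
    ∫ t, a t * b t ∂circleProb = fourierCoef a 0 * fourierCoef b 0 := by
  have hA : ha.toLp a =ᵐ[circleProb] a := ha.coeFn_toLp
  have hB : hb.star.toLp (star b) =ᵐ[circleProb] star b := hb.star.coeFn_toLp
  have h1 : ∫ t, a t * b t ∂circleProb = inner ℂ (hb.star.toLp (star b)) (ha.toLp a) := by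
    rw [L2.inner_def]
    refine integral_congr_ae ?_
    filter_upwards [hA, hB] with t h1 h2
    rw [h1, h2, RCLike.inner_apply]
    simp
  have h2 (n : ℤ) : inner ℂ (charL2 n) (ha.toLp a) = fourierCoef a n := by
    rw [inner_charL2, fourierCoef_congr hA]
  have h3 (n : ℤ) : inner ℂ (hb.star.toLp (star b)) (charL2 n) = fourierCoef b (-n) := by
    rw [← inner_conj_symm, inner_charL2, fourierCoef_congr hB]
    change star (fourierCoef (fun t => star (b t)) n) = _
    rw [fourierCoef_star, star_star]
  rw [h1, ← charBasis.tsum_inner_mul_inner]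
  simp only [charBasis, HilbertBasis.coe_mkOfOrthogonalEqBot, h2, h3]
  rw [tsum_eq_single 0]
  · simp [mul_comm]
  · intro n hn
    rcases lt_or_gt_of_ne hn with h | h
    · rw [ha0 n h, mul_zero]
    · rw [hb0 (-n) (by omega), zero_mul]

/-! ### A Smirnov type theorem for sums of products of Hardy functions -/

/-- Convergence of both factors in `L²` suffices to pass to the limit in the integral of their
product against a bounded function. -/
lemma tendsto_integral_mul_mul {b : ℝ → ℂ} {M : ℝ} (hb : AEStronglyMeasurable b circleProb)
    (hM : ∀ᵐ t ∂circleProb, ‖b t‖ ≤ M) {u v : ℕ → Lp ℂ 2 circleProb} {u₀ v₀ : Lp ℂ 2 circleProb}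
    (hu : Tendsto u atTop (𝓝 u₀)) (hv : Tendsto v atTop (𝓝 v₀)) :
    Tendsto (fun n => ∫ t, b t * (u n t * v n t) ∂circleProb) atTop
      (𝓝 (∫ t, b t * (u₀ t * v₀ t) ∂circleProb)) := by
  have hbv (y : Lp ℂ 2 circleProb) : MemLp (fun t => b t * y t) 2 circleProb :=
    (Lp.memLp y).mul (memLp_top_of_bound hb M hM)
  have key (x y : Lp ℂ 2 circleProb) :
      ∫ t, b t * (x t * y t) ∂circleProb = inner ℂ (star x) ((hbv y).toLp _) := by
    rw [L2.inner_def]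
    refine integral_congr_ae ?_
    filter_upwards [(hbv y).coeFn_toLp, Lp.coeFn_star x] with t h1 h2
    rw [h1, h2, RCLike.inner_apply]
    simp only [Pi.star_apply, Complex.star_def, Complex.conj_conj]
    ring
  have hlip (x y : Lp ℂ 2 circleProb) : ‖(hbv x).toLp _ - (hbv y).toLp _‖ ≤ M * ‖x - y‖ := by
    refine Lp.norm_le_mul_norm_of_ae_le_mul ?_
    filter_upwards [(hbv x).coeFn_toLp, (hbv y).coeFn_toLp, hM, Lp.coeFn_sub x y,
      Lp.coeFn_sub ((hbv x).toLp _) ((hbv y).toLp _)] with t h1 h2 h3 h4 h5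
    rw [h5, Pi.sub_apply, h1, h2, h4, Pi.sub_apply, ← mul_sub, norm_mul]
    gcongr
  have hv' : Tendsto (fun n => (hbv (v n)).toLp _) atTop (𝓝 ((hbv v₀).toLp _)) := by
    rw [tendsto_iff_norm_sub_tendsto_zero] at hv ⊢
    refine squeeze_zero (fun _ => norm_nonneg _) (fun n => hlip _ _) ?_
    simpa using hv.const_mul M
  have hu' : Tendsto (fun n => star (u n)) atTop (𝓝 (star u₀)) := by
    rw [tendsto_iff_norm_sub_tendsto_zero] at hu ⊢
    refine squeeze_zero (fun _ => norm_nonneg _) (fun n => ?_) hu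
    refine Lp.norm_le_norm_of_ae_le ?_
    filter_upwards [Lp.coeFn_star (u n), Lp.coeFn_star u₀, Lp.coeFn_sub (u n) u₀,
      Lp.coeFn_sub (star (u n)) (star u₀)] with t h1 h2 h3 h4
    rw [h4, Pi.sub_apply, h1, h2, h3, Pi.star_apply, Pi.star_apply, Pi.sub_apply, ← star_sub,
      norm_star]
  simp only [key]
  exact hu'.inner hv'

/-- The analytic trigonometric polynomial `P(exp (i t))` attached to `P`. -/
noncomputable def analyticPoly (P : Polynomial ℂ) (t : ℝ) : ℂ := P.eval (char 1 t)

lemma char_one_pow (n : ℕ) (t : ℝ) : char 1 t ^ n = char n t := by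
  induction n with
  | zero => simp [char_zero]
  | succ n ih => rw [pow_succ, ih, ← char_add]; push_cast; rfl

lemma continuous_analyticPoly (P : Polynomial ℂ) : Continuous (analyticPoly P) :=
  P.continuous.comp (continuous_char 1)

lemma exists_norm_analyticPoly_le (P : Polynomial ℂ) : ∃ M, ∀ t, ‖analyticPoly P t‖ ≤ M := by
  refine ⟨∑ i ∈ P.support, ‖P.coeff i‖, fun t => ?_⟩
  rw [analyticPoly, Polynomial.eval_eq_sum, Polynomial.sum]
  refine (norm_sum_le _ _).trans_eq (Finset.sum_congr rfl fun i _ => ?_)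
  rw [norm_mul, char_one_pow, norm_char, mul_one]

lemma fourierCoef_analyticPoly_mul {f : ℝ → ℂ} (hf : Integrable f circleProb) (P : Polynomial ℂ)
    (n : ℤ) : fourierCoef (fun t => analyticPoly P t * f t) n =
      ∑ i ∈ P.support, P.coeff i * fourierCoef f (n - i) := by
  simp only [analyticPoly, Polynomial.eval_eq_sum, Polynomial.sum, Finset.sum_mul, char_one_pow,
    mul_assoc]
  rw [fourierCoef_sum]
  · simp only [fourierCoef_const_mul, fourierCoef_char_mul]
  · exact fun i _ => (integrable_char_mul hf _).const_mul _

lemma fourierCoef_analyticPoly_mul_of_neg {f : ℝ → ℂ} (hf : Integrable f circleProb)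
    (hf0 : ∀ n < 0, fourierCoef f n = 0) (P : Polynomial ℂ) {n : ℤ} (hn : n < 0) :
    fourierCoef (fun t => analyticPoly P t * f t) n = 0 := by
  rw [fourierCoef_analyticPoly_mul hf]
  refine Finset.sum_eq_zero fun i _ => ?_
  rw [hf0 _ (by omega), mul_zero]

lemma fourierCoef_analyticPoly_mul_zero {f : ℝ → ℂ} (hf : Integrable f circleProb)
    (hf0 : ∀ n < 0, fourierCoef f n = 0) (P : Polynomial ℂ) :
    fourierCoef (fun t => analyticPoly P t * f t) 0 = P.coeff 0 * fourierCoef f 0 := by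
  rw [fourierCoef_analyticPoly_mul hf, Finset.sum_eq_single 0]
  · simp
  · intro i _ hi
    rw [hf0 _ (by omega), mul_zero]
  · intro h
    rw [Polynomial.notMem_support_iff.1 h, zero_mul]

/-- An outer function of modulus proportional to `q ^ (-1/2)`, obtained by Szegő's extremal problem:
`κ √q` is the component of `√q` orthogonal to all `exp (i n t) √q`, `n ≥ 1`, so that `|κ|² q` is
orthogonal to all nontrivial characters and hence constant. Multiplication by `κ²` preserves
integrable functions of Hardy type that are `O(q)`, and makes them bounded. -/
theorem exists_outer {q : ℝ → ℝ} (hq : Integrable q circleProb) (hq1 : ∀ t, 1 ≤ q t) :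
    ∃ κ : ℝ → ℂ, AEStronglyMeasurable κ circleProb ∧
      (∀ᵐ t ∂circleProb, ‖κ t‖ ^ 2 * q t ≤ ∫ t, q t ∂circleProb) ∧
      ∫ t, ‖κ t - 1‖ ^ 2 ∂circleProb ≤ ∫ t, q t ∂circleProb - 1 ∧
      ∀ f : ℝ → ℂ, Integrable f circleProb → (∃ M, ∀ t, ‖f t‖ ≤ M * q t) →
        (∀ n < 0, fourierCoef f n = 0) →
        (∀ n < 0, fourierCoef (fun t => κ t ^ 2 * f t) n = 0) ∧
          fourierCoef (fun t => κ t ^ 2 * f t) 0 = fourierCoef f 0 := by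
  set s : ℝ → ℂ := fun t => (Real.sqrt (q t) : ℂ) with hs
  have hsq (t) : s t * s t = q t := by
    rw [hs, ← Complex.ofReal_mul, Real.mul_self_sqrt (zero_le_one.trans (hq1 t))]
  have hs1 (t) : 1 ≤ ‖s t‖ := by
    simp only [hs, Complex.norm_real, Real.norm_of_nonneg (Real.sqrt_nonneg _)]
    exact Real.one_le_sqrt.2 (hq1 t)
  have hs0 (t) : s t ≠ 0 := fun h => by have := hs1 t; rw [h, norm_zero] at this; linarith
  have hsn (t) : ‖s t‖ ^ 2 = q t := by
    simp only [hs, Complex.norm_real, Real.norm_eq_abs, sq_abs]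
    exact Real.sq_sqrt (zero_le_one.trans (hq1 t))
  have hsm : AEStronglyMeasurable s circleProb :=
    (Complex.continuous_ofReal.comp Real.continuous_sqrt).comp_aestronglyMeasurable hq.1
  have hs2 : MemLp s 2 circleProb :=
    (memLp_two_iff_integrable_sq_norm hsm).2 (hq.congr (.of_forall fun t => (hsn t).symm))
  have hPs (P : Polynomial ℂ) : MemLp (fun t => analyticPoly P t * s t) 2 circleProb := by
    obtain ⟨M, hM⟩ := exists_norm_analyticPoly_le P
    exact hs2.mul (memLp_top_of_bound (continuous_analyticPoly P).aestronglyMeasurable M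
      (.of_forall hM))
  let Λ : Polynomial ℂ →ₗ[ℂ] Lp ℂ 2 circleProb :=
    { toFun := fun P => (hPs P).toLp _
      map_add' := fun P Q => by
        rw [← MemLp.toLp_add]
        exact MemLp.toLp_congr _ _ (.of_forall fun t => by simp [analyticPoly, add_mul])
      map_smul' := fun c P => by
        rw [RingHom.id_apply, ← MemLp.toLp_const_smul]
        exact MemLp.toLp_congr _ _ (.of_forall fun t => by simp [analyticPoly, mul_assoc]) }
  have hΛ (P) : Λ P =ᵐ[circleProb] fun t => analyticPoly P t * s t := (hPs P).coeFn_toLp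
  let K : Submodule ℂ (Lp ℂ 2 circleProb) :=
    (LinearMap.range (Λ ∘ₗ LinearMap.mulLeft ℂ Polynomial.X)).topologicalClosure
  have : CompleteSpace K := (Submodule.isClosed_topologicalClosure _).completeSpace_coe
  set ψ : Lp ℂ 2 circleProb := Λ 1 - K.starProjection (Λ 1) with hψ
  have horth (Q : Polynomial ℂ) : inner ℂ (Λ (Polynomial.X * Q)) ψ = 0 :=
    K.sub_starProjection_mem_orthogonal (Λ 1) _
      (Submodule.le_topologicalClosure _ ⟨Q, rfl⟩)
  obtain ⟨P, hP0, hP⟩ : ∃ P : ℕ → Polynomial ℂ, (∀ n, (P n).coeff 0 = 1) ∧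
      Tendsto (fun n => Λ (P n)) atTop (𝓝 ψ) := by
    have hmem : K.starProjection (Λ 1) ∈ closure
        (LinearMap.range (Λ ∘ₗ LinearMap.mulLeft ℂ Polynomial.X) : Set (Lp ℂ 2 circleProb)) := by
      rw [← Submodule.topologicalClosure_coe]
      exact K.starProjection_apply_mem _
    obtain ⟨x, hx, hlim⟩ := mem_closure_iff_seq_limit.1 hmem
    choose Q hQ using hx
    refine ⟨fun n => 1 - Polynomial.X * Q n, fun n => by simp, ?_⟩
    simp only [map_sub]
    exact tendsto_const_nhds.sub (hlim.congr fun n => (hQ n).symm)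
  -- `|ψ|²` is constant
  have hψ2 : Integrable (fun t => ψ t * star (ψ t)) circleProb :=
    (Lp.memLp ψ).integrable_mul (Lp.memLp ψ).star
  have hcoef (n : ℤ) (hn : 0 < n) : fourierCoef (fun t => ψ t * star (ψ t)) (-n) = 0 := by
    obtain ⟨k, rfl⟩ : ∃ k : ℕ, n = k + 1 := ⟨(n - 1).toNat, by omega⟩
    have h1 := tendsto_integral_mul_mul (M := 1) (aestronglyMeasurable_char (k + 1) circleProb)
      (.of_forall fun t => (norm_char _ t).le) hP (tendsto_const_nhds (x := star ψ))
    have h2 (j : ℕ) : ∫ t, char (k + 1) t * ((Λ (P j)) t * (star ψ : Lp ℂ 2 circleProb) t)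
        ∂circleProb = star (inner ℂ (Λ (Polynomial.X * (Polynomial.X ^ k * P j))) ψ) := by
      rw [Complex.star_def, inner_conj_symm, L2.inner_def]
      refine integral_congr_ae ?_
      filter_upwards [hΛ (P j), Lp.coeFn_star ψ,
        hΛ (Polynomial.X * (Polynomial.X ^ k * P j))] with t h1 h2 h3
      rw [h1, h2, h3, RCLike.inner_apply]
      simp only [analyticPoly, Polynomial.eval_mul, Polynomial.eval_X, Polynomial.eval_pow,
        Pi.star_apply, char_one_pow, Complex.star_def]
      rw [add_comm (k : ℤ) 1, char_add]
      ring
    simp only [h2, horth, star_zero] at h1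
    rw [fourierCoef_eq, neg_neg, tendsto_nhds_unique tendsto_const_nhds h1]
    refine integral_congr_ae ?_
    filter_upwards [Lp.coeFn_star ψ] with t h1
    rw [h1]; rfl
  obtain ⟨c, hc, hcq⟩ : ∃ c : ℝ, (∀ᵐ t ∂circleProb, ‖ψ t‖ ^ 2 = c) ∧ c ≤ ∫ t, q t ∂circleProb := by
    have hre (t) : ψ t * star (ψ t) = ((‖ψ t‖ ^ 2 : ℝ) : ℂ) := by
      rw [Complex.star_def, Complex.mul_conj, Complex.normSq_eq_norm_sq]
    refine ⟨∫ t, ‖ψ t‖ ^ 2 ∂circleProb, ?_, ?_⟩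
    · have h0 : fourierCoef (fun t => ψ t * star (ψ t)) 0 =
          ((∫ t, ‖ψ t‖ ^ 2 ∂circleProb : ℝ) : ℂ) := by
        simp only [fourierCoef_eq, neg_zero, char_zero, one_mul, hre, integral_complex_ofReal]
      have hz := ae_eq_zero_of_fourierCoef_eq_zero
        (hψ2.sub (integrable_const ((∫ t, ‖ψ t‖ ^ 2 ∂circleProb : ℝ) : ℂ))) (fun n => by
          have hk : fourierCoef (fun _ => ((∫ t, ‖ψ t‖ ^ 2 ∂circleProb : ℝ) : ℂ)) n =
              if n = 0 then ((∫ t, ‖ψ t‖ ^ 2 ∂circleProb : ℝ) : ℂ) else 0 := by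
            have := fourierCoef_const_mul (char 0) ((∫ t, ‖ψ t‖ ^ 2 ∂circleProb : ℝ) : ℂ) n
            simp only [char_zero, mul_one, fourierCoef_char] at this
            rw [this]; simp
          rw [show ((fun t => ψ t * star (ψ t)) - fun _ =>
            ((∫ t, ‖ψ t‖ ^ 2 ∂circleProb : ℝ) : ℂ)) = fun t => ψ t * star (ψ t) -
              ((∫ t, ‖ψ t‖ ^ 2 ∂circleProb : ℝ) : ℂ) from rfl,
            fourierCoef_sub hψ2 (integrable_const _), hk]
          rcases lt_trichotomy n 0 with hn | hn | hn
          · have := hcoef (-n) (by omega)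
            rw [neg_neg] at this
            rw [this, if_neg hn.ne, sub_zero]
          · subst hn
            rw [h0, if_pos rfl, sub_self]
          · have := hcoef n hn
            have h' := fourierCoef_star (fun t => ψ t * star (ψ t)) n
            simp only [star_mul, star_star] at h'
            rw [h', this, star_zero, if_neg hn.ne', sub_zero])
      filter_upwards [hz] with t ht
      have : ψ t * star (ψ t) = ((∫ t, ‖ψ t‖ ^ 2 ∂circleProb : ℝ) : ℂ) := sub_eq_zero.1 ht
      rw [hre] at this
      exact_mod_cast this
    · have h2 : ∫ t, q t ∂circleProb = ‖Λ 1‖ ^ 2 := by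
        rw [norm_sq_eq_integral]
        refine integral_congr_ae ?_
        filter_upwards [hΛ 1] with t ht
        rw [ht, ← hsn]; simp [analyticPoly]
      have h3 : ‖ψ‖ ≤ ‖Λ 1‖ := by
        have : ψ = Kᗮ.starProjection (Λ 1) := by
          rw [hψ, Submodule.starProjection_orthogonal']; rfl
        rw [this]
        exact Kᗮ.norm_starProjection_apply_le _
      rw [← norm_sq_eq_integral, h2]
      gcongr
  set κ : ℝ → ℂ := fun t => ψ t / s t with hκ
  have hκm : AEStronglyMeasurable κ circleProb :=
    ((Lp.aestronglyMeasurable ψ).aemeasurable.div hsm.aemeasurable).aestronglyMeasurable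
  have hκq : ∀ᵐ t ∂circleProb, ‖κ t‖ ^ 2 * q t = c := by
    filter_upwards [hc] with t ht
    have : q t ≠ 0 := by linarith [hq1 t]
    rw [hκ, norm_div, div_pow, hsn, ht, div_mul_cancel₀ _ this]
  have hκc : ∀ᵐ t ∂circleProb, ‖κ t‖ ^ 2 ≤ c := by
    filter_upwards [hκq] with t ht
    rw [← ht]
    exact le_mul_of_one_le_right (by positivity) (hq1 t)
  have hκ2 : MemLp κ 2 circleProb := by
    refine MemLp.of_bound hκm (Real.sqrt c) ?_
    filter_upwards [hκc] with t ht
    exact Real.le_sqrt_of_sq_le ht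
  refine ⟨κ, hκm, hκq.mono fun t ht => ht.trans_le hcq, ?_, ?_⟩
  · have hκi : Integrable κ circleProb := hκ2.integrable one_le_two
    have hint : ∫ t, κ t ∂circleProb = 1 := by
      have h1 := tendsto_integral_mul_mul (b := fun t => (s t * s t)⁻¹) (M := 1)
        (hsm.aemeasurable.mul hsm.aemeasurable).inv.aestronglyMeasurable
        (.of_forall fun t => by
          rw [norm_inv, norm_mul]
          exact inv_le_one_of_one_le₀ (one_le_mul_of_one_le_of_one_le (hs1 t) (hs1 t)))
        hP (tendsto_const_nhds (x := Λ 1))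
      have h2 (x : Lp ℂ 2 circleProb) :
          ∫ t, (s t * s t)⁻¹ * (x t * Λ 1 t) ∂circleProb = ∫ t, x t / s t ∂circleProb := by
        refine integral_congr_ae ?_
        filter_upwards [hΛ 1] with t ht
        rw [ht]
        have := hs0 t
        simp only [analyticPoly, Polynomial.eval_one, one_mul]
        field_simp
      simp only [h2] at h1
      refine tendsto_nhds_unique h1 (tendsto_const_nhds.congr fun n => ?_)
      have h3 := fourierCoef_analyticPoly_mul_zero (f := char 0)
        ((integrable_const (1 : ℂ)).congr (.of_forall fun t => (char_zero t).symm))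
        (fun n hn => by rw [fourierCoef_char, if_neg hn.ne]) (P n)
      rw [hP0, fourierCoef_char, if_pos rfl, mul_one, fourierCoef_eq] at h3
      rw [← h3]
      refine integral_congr_ae ?_
      filter_upwards [hΛ (P n)] with t ht
      have := hs0 t
      rw [ht, mul_div_assoc, div_self this]
      simp [char_zero]
    have hre : ∫ t, (κ t).re ∂circleProb = 1 := by
      have := integral_re hκi
      simp only [RCLike.re_to_complex] at this
      rw [this, hint]; rfl
    have h2 : Integrable (fun t => ‖κ t‖ ^ 2) circleProb := hκ2.norm.integrable_sq
    have h3 (t) : ‖κ t - 1‖ ^ 2 = ‖κ t‖ ^ 2 - 2 * (κ t).re + 1 := by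
      simp only [← Complex.normSq_eq_norm_sq, Complex.normSq_sub]
      simp; ring
    simp only [h3]
    have hκr : Integrable (fun t => 2 * (κ t).re) circleProb := hκi.re.const_mul 2
    rw [integral_add (f := fun t => ‖κ t‖ ^ 2 - 2 * (κ t).re) (h2.sub hκr) (integrable_const _),
      integral_sub h2 hκr, integral_const_mul]
    simp only [hre, integral_const, probReal_univ, smul_eq_mul]
    have h4 : ∫ t, ‖κ t‖ ^ 2 ∂circleProb ≤ c := by
      have := integral_mono_ae h2 (integrable_const c) hκc
      simpa using this
    linarith
  · rintro f hf ⟨M, hM⟩ hf0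
    have hlim (n : ℤ) : Tendsto
        (fun j => fourierCoef (fun t => analyticPoly (P j * P j) t * f t) n) atTop
        (𝓝 (fourierCoef (fun t => κ t ^ 2 * f t) n)) := by
      have h1 := tendsto_integral_mul_mul (b := fun t => char (-n) t * (f t / (s t * s t))) (M := M)
        ((aestronglyMeasurable_char (-n) circleProb).mul
          (hf.1.aemeasurable.div (hsm.aemeasurable.mul hsm.aemeasurable)).aestronglyMeasurable)
        (.of_forall fun t => by
          have : (0 : ℝ) < q t := by linarith [hq1 t]
          rw [norm_mul, norm_char, one_mul, norm_div, hsq, Complex.norm_real,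
            Real.norm_of_nonneg this.le, div_le_iff₀ this]
          exact hM t) hP hP
      convert! h1 using 1
      · ext j
        rw [fourierCoef_eq]
        refine integral_congr_ae ?_
        filter_upwards [hΛ (P j)] with t ht
        have := hs0 t
        rw [ht]
        simp only [analyticPoly, Polynomial.eval_mul]
        field_simp
      · rw [fourierCoef_eq]
        congr 2
        ext t
        have := hs0 t
        simp only [hκ]
        field_simp
    constructor
    · intro n hn
      refine tendsto_nhds_unique (hlim n) (tendsto_const_nhds.congr fun j => ?_)
      rw [fourierCoef_analyticPoly_mul_of_neg hf hf0 _ hn]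
    · refine tendsto_nhds_unique (hlim 0) (tendsto_const_nhds.congr fun j => ?_)
      rw [fourierCoef_analyticPoly_mul_zero hf hf0, Polynomial.mul_coeff_zero, hP0]
      simp

/-- If `f p` and `g p` are integrable functions of Hardy type and `∑ p, f p * g p` is integrable,
then the integral of this sum is determined by the constant Fourier coefficients, although the
single products need not be integrable. -/
theorem integral_sum_mul_of_fourierCoef_eq_zero {ι : Type*} [Fintype ι] {f g : ι → ℝ → ℂ}
    (hf : ∀ p, Integrable (f p) circleProb) (hg : ∀ p, Integrable (g p) circleProb)
    (hf0 : ∀ p, ∀ n < 0, fourierCoef (f p) n = 0) (hg0 : ∀ p, ∀ n < 0, fourierCoef (g p) n = 0)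
    (hfg : Integrable (fun t => ∑ p, f p t * g p t) circleProb) :
    ∫ t, ∑ p, f p t * g p t ∂circleProb = ∑ p, fourierCoef (f p) 0 * fourierCoef (g p) 0 := by
  set ρ : ℝ → ℝ := fun t => ∑ p, (‖f p t‖ + ‖g p t‖) with hρ
  have hρi : Integrable ρ circleProb :=
    integrable_finsetSum _ fun p _ => (hf p).norm.add (hg p).norm
  have hρ0 (t) : 0 ≤ ρ t := Finset.sum_nonneg fun p _ => by positivity
  set I := ∫ t, ρ t ∂circleProb with hI
  have hI0 : 0 ≤ I := integral_nonneg hρ0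
  have hfρ (p t) : ‖f p t‖ ≤ ρ t :=
    (le_add_of_nonneg_right (norm_nonneg _)).trans (Finset.single_le_sum
      (f := fun p => ‖f p t‖ + ‖g p t‖) (fun p _ => by positivity) (Finset.mem_univ p))
  have hgρ (p t) : ‖g p t‖ ≤ ρ t :=
    (le_add_of_nonneg_left (norm_nonneg _)).trans (Finset.single_le_sum
      (f := fun p => ‖f p t‖ + ‖g p t‖) (fun p _ => by positivity) (Finset.mem_univ p))
  have step (ε : ℝ) (hε : 0 < ε) : ∃ κ : ℝ → ℂ, AEStronglyMeasurable κ circleProb ∧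
      (∀ᵐ t ∂circleProb, ‖κ t‖ ^ 2 ≤ 1 + ε * I) ∧ ∫ t, ‖κ t - 1‖ ^ 2 ∂circleProb ≤ ε * I ∧
      ∫ t, κ t ^ 4 * ∑ p, f p t * g p t ∂circleProb =
        ∑ p, fourierCoef (f p) 0 * fourierCoef (g p) 0 := by
    have hq : Integrable (fun t => 1 + ε * ρ t) circleProb :=
      (integrable_const _).add (hρi.const_mul ε)
    have hq1 (t) : 1 ≤ 1 + ε * ρ t := le_add_of_nonneg_right (mul_nonneg hε.le (hρ0 t))
    have hqI : ∫ t, (1 + ε * ρ t) ∂circleProb = 1 + ε * I := by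
      rw [integral_add (integrable_const _) (hρi.const_mul ε), integral_const_mul]
      simp [hI]
    obtain ⟨κ, hκm, hκb, hκ1, hκ⟩ := exists_outer hq hq1
    rw [hqI] at hκb hκ1
    have hρq (t) : ρ t ≤ ε⁻¹ * (1 + ε * ρ t) := by
      rw [mul_add, inv_mul_cancel_left₀ hε.ne']
      have : 0 < ε⁻¹ := inv_pos.2 hε
      linarith
    have hbdd {u : ℝ → ℂ} (hu : AEStronglyMeasurable u circleProb) (huρ : ∀ t, ‖u t‖ ≤ ρ t) :
        MemLp (fun t => κ t ^ 2 * u t) 2 circleProb := by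
      refine MemLp.of_bound ((hκm.pow 2).mul hu) (ε⁻¹ * (1 + ε * I)) ?_
      filter_upwards [hκb] with t ht
      rw [norm_mul, norm_pow]
      calc ‖κ t‖ ^ 2 * ‖u t‖ ≤ ‖κ t‖ ^ 2 * (ε⁻¹ * (1 + ε * ρ t)) := by
            gcongr; exact (huρ t).trans (hρq t)
        _ = ε⁻¹ * (‖κ t‖ ^ 2 * (1 + ε * ρ t)) := by ring
        _ ≤ _ := by gcongr
    refine ⟨κ, hκm, ?_, by linarith, ?_⟩
    · filter_upwards [hκb] with t ht
      exact (le_mul_of_one_le_right (by positivity) (hq1 t)).trans ht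
    · have h1 (t) : κ t ^ 4 * ∑ p, f p t * g p t =
          ∑ p, (κ t ^ 2 * f p t) * (κ t ^ 2 * g p t) := by
        rw [Finset.mul_sum]
        exact Finset.sum_congr rfl fun p _ => by ring
      simp only [h1]
      rw [integral_finsetSum]
      · refine Finset.sum_congr rfl fun p _ => ?_
        have hF := hκ (f p) (hf p) ⟨ε⁻¹, fun t => (hfρ p t).trans (hρq t)⟩ (hf0 p)
        have hG := hκ (g p) (hg p) ⟨ε⁻¹, fun t => (hgρ p t).trans (hρq t)⟩ (hg0 p)
        rw [integral_mul_of_fourierCoef_eq_zero (hbdd (hf p).1 (hfρ p)) (hbdd (hg p).1 (hgρ p))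
          hF.1 hG.1, hF.2, hG.2]
      · exact fun p _ => (hbdd (hf p).1 (hfρ p)).integrable_mul (hbdd (hg p).1 (hgρ p))
  have hε (n : ℕ) : (0 : ℝ) < 1 / (n + 1) := by positivity
  choose κ hκm hκb hκ1 hκ using fun n : ℕ => step (1 / (n + 1)) (hε n)
  have hεle (n : ℕ) : (1 : ℝ) / (n + 1) ≤ 1 := by
    rw [div_le_one (by positivity)]; linarith [n.cast_nonneg (α := ℝ)]
  have hκb' (n : ℕ) : ∀ᵐ t ∂circleProb, ‖κ n t‖ ^ 2 ≤ 1 + I := by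
    filter_upwards [hκb n] with t ht
    exact ht.trans (by nlinarith [hεle n])
  -- convergence `κ n → 1` in measure
  have hmeas : TendstoInMeasure circleProb κ atTop (fun _ => (1 : ℂ)) := by
    refine tendstoInMeasure_of_tendsto_eLpNorm (p := 2) two_ne_zero hκm
      aestronglyMeasurable_const ?_
    have hmem (n : ℕ) : MemLp (κ n - fun _ => (1 : ℂ)) 2 circleProb := by
      refine MemLp.sub (MemLp.of_bound (hκm n) (Real.sqrt (1 + I)) ?_) (memLp_const _)
      filter_upwards [hκb' n] with t ht
      exact Real.le_sqrt_of_sq_le ht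
    have hnorm (n : ℕ) : eLpNorm (κ n - fun _ => (1 : ℂ)) 2 circleProb ≤
        ENNReal.ofReal (Real.sqrt (1 / (n + 1) * I)) := by
      rw [(hmem n).eLpNorm_eq_integral_rpow_norm two_ne_zero ENNReal.ofNat_ne_top]
      refine ENNReal.ofReal_le_ofReal ?_
      rw [ENNReal.toReal_ofNat, ← one_div, ← Real.sqrt_eq_rpow]
      refine Real.sqrt_le_sqrt ?_
      simpa using hκ1 n
    have h0 : Tendsto (fun n : ℕ => ENNReal.ofReal (Real.sqrt (1 / (n + 1) * I))) atTop (𝓝 0) := by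
      rw [← ENNReal.ofReal_zero, ← Real.sqrt_zero, ← zero_mul I]
      exact ENNReal.tendsto_ofReal
        ((tendsto_one_div_add_atTop_nhds_zero_nat.mul_const I).sqrt)
    exact tendsto_of_tendsto_of_tendsto_of_le_of_le tendsto_const_nhds h0
      (fun _ => zero_le) hnorm
  obtain ⟨ns, -, hns⟩ := hmeas.exists_seq_tendsto_ae
  have hdct := tendsto_integral_of_dominated_convergence
    (F := fun n t => κ (ns n) t ^ 4 * ∑ p, f p t * g p t) (f := fun t => ∑ p, f p t * g p t)
    (μ := circleProb) (fun t => (1 + I) ^ 2 * ‖∑ p, f p t * g p t‖)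
    (fun n => ((hκm _).pow 4).mul hfg.1) (hfg.norm.const_mul _)
    (fun n => by
      filter_upwards [hκb' (ns n)] with t ht
      rw [norm_mul, norm_pow, show ‖κ (ns n) t‖ ^ 4 = (‖κ (ns n) t‖ ^ 2) ^ 2 by ring]
      gcongr)
    (by
      filter_upwards [hns] with t ht
      simpa using (ht.pow 4).mul_const (∑ p, f p t * g p t))
  simp only [hκ] at hdct
  exact tendsto_nhds_unique hdct tendsto_const_nhds

/-! ### Square integrable vector functions and the rows of matrix functions -/

section Sqrt

open scoped MatrixOrder Matrix.Norms.L2Operator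

/-- A measurable Hermitian square root of a positive semidefinite matrix function, obtained from
the continuity of the square root on positive semidefinite matrices. -/
theorem exists_measurable_sqrt {T : ℕ} {V : ℝ → Matrix (Fin T) (Fin T) ℂ}
    (hV : ∀ p q, AEStronglyMeasurable (fun t => V t p q) circleProb)
    (hV0 : ∀ᵐ t ∂circleProb, (V t).PosSemidef) :
    ∃ S : ℝ → Matrix (Fin T) (Fin T) ℂ,
      (∀ p q, AEStronglyMeasurable (fun t => S t p q) circleProb) ∧
      ∀ᵐ t ∂circleProb, (S t)ᴴ = S t ∧ S t * S t = V t := by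
  classical
  refine ⟨fun t => CFC.sqrt (V t), fun p q => ?_, ?_⟩
  · let A : Set (Fin T → Fin T → ℂ) := {a | (0 : Matrix (Fin T) (Fin T) ℂ) ≤ Matrix.of a}
    have hA : IsClosed A := CStarAlgebra.isClosed_nonneg (A := Matrix (Fin T) (Fin T) ℂ)
    let g : (Fin T → Fin T → ℂ) → ℂ := fun a => CFC.sqrt (Matrix.of a) p q
    have hg : ContinuousOn g A := by
      have h1 : ContinuousOn (CFC.sqrt : Matrix (Fin T) (Fin T) ℂ → _) {a | 0 ≤ a} :=
        CFC.continuousOn_sqrt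
      have h2 : Continuous fun a : Matrix (Fin T) (Fin T) ℂ => a p q :=
        (continuous_apply q).comp (continuous_apply p)
      exact h2.comp_continuousOn h1
    have hm : Measurable (A.piecewise g 0) :=
      hg.measurable_piecewise continuousOn_const hA.measurableSet
    have hVm : AEMeasurable (fun t p q => V t p q) circleProb :=
      aemeasurable_pi_iff.2 fun i => aemeasurable_pi_iff.2 fun j => (hV i j).aemeasurable
    refine AEMeasurable.aestronglyMeasurable ((hm.comp_aemeasurable hVm).congr ?_)
    filter_upwards [hV0] with t ht
    exact Set.piecewise_eq_of_mem A g 0 (show (fun p q => V t p q) ∈ A from ht.nonneg)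
  · filter_upwards [hV0] with t ht
    exact ⟨(CFC.sqrt_nonneg (V t)).posSemidef.isHermitian,
      CFC.sqrt_mul_sqrt_self (V t) ht.nonneg⟩

end Sqrt

variable {T : ℕ}

/-- The Hilbert space of square integrable `ℂ^T`-valued functions on the circle. -/
abbrev VecL2 (T : ℕ) : Type := Lp (EuclideanSpace ℂ (Fin T)) 2 circleProb

/-- All components of the vector function are square integrable. -/
def SqIntegrable (f : ℝ → Fin T → ℂ) : Prop := ∀ p, MemLp (fun t => f t p) 2 circleProb

/-- A square integrable vector function as an element of the Hilbert space. -/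
noncomputable def vecL2 (f : ℝ → Fin T → ℂ) (hf : SqIntegrable f) : VecL2 T :=
  (memLp_piLp_iff.2 hf : MemLp (fun t => WithLp.toLp 2 (f t)) 2 circleProb).toLp _

lemma coeFn_vecL2 (f : ℝ → Fin T → ℂ) (hf : SqIntegrable f) :
    ∀ᵐ t ∂circleProb, WithLp.ofLp (vecL2 f hf t) = f t :=
  ((memLp_piLp_iff.2 hf : MemLp (fun t => WithLp.toLp 2 (f t)) 2 circleProb).coeFn_toLp).mono
    fun t ht => by rw [vecL2, ht]

lemma sqIntegrable_coeFn (φ : VecL2 T) : SqIntegrable fun t => WithLp.ofLp (φ t) :=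
  memLp_piLp_iff.1 (Lp.memLp φ)

lemma eq_vecL2 {φ : VecL2 T} {f : ℝ → Fin T → ℂ} (hf : SqIntegrable f)
    (h : ∀ᵐ t ∂circleProb, WithLp.ofLp (φ t) = f t) : φ = vecL2 f hf := by
  refine Lp.ext ?_
  filter_upwards [h, coeFn_vecL2 f hf] with t h1 h2
  exact WithLp.ofLp_injective 2 (h1.trans h2.symm)

lemma SqIntegrable.integrable_dotProduct_star {f g : ℝ → Fin T → ℂ} (hf : SqIntegrable f)
    (hg : SqIntegrable g) : Integrable (fun t => f t ⬝ᵥ star (g t)) circleProb :=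
  integrable_finsetSum _ fun p _ => (hf p).integrable_mul (hg p).star

lemma inner_eq_integral (φ ψ : VecL2 T) :
    inner ℂ φ ψ = ∫ t, WithLp.ofLp (ψ t) ⬝ᵥ star (WithLp.ofLp (φ t)) ∂circleProb := by
  rw [L2.inner_def]
  rfl

lemma norm_vecL2_le {f g : ℝ → Fin T → ℂ} (hf : SqIntegrable f) (hg : SqIntegrable g) {M : ℝ}
    (h : ∀ᵐ t ∂circleProb, ∀ p, ‖f t p‖ ≤ M * ‖g t p‖) : ‖vecL2 f hf‖ ≤ M * ‖vecL2 g hg‖ := by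
  rcases lt_or_ge M 0 with hM | hM
  · have h0 : vecL2 f hf = 0 := by
      symm
      refine eq_vecL2 hf ?_
      filter_upwards [h, Lp.coeFn_zero (EuclideanSpace ℂ (Fin T)) 2 circleProb] with t ht h0
      rw [h0]
      ext p
      have := (ht p).trans (mul_nonpos_of_nonpos_of_nonneg hM.le (norm_nonneg _))
      simp [norm_le_zero_iff.1 this]
    have h0' : vecL2 g hg = 0 := by
      symm
      refine eq_vecL2 hg ?_
      filter_upwards [h, Lp.coeFn_zero (EuclideanSpace ℂ (Fin T)) 2 circleProb] with t ht h0
      rw [h0]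
      ext p
      have : ‖g t p‖ ≤ 0 := by nlinarith [ht p, norm_nonneg (f t p), norm_nonneg (g t p)]
      simp [norm_le_zero_iff.1 this]
    rw [h0, h0']; simp
  · refine Lp.norm_le_mul_norm_of_ae_le_mul ?_
    filter_upwards [h, coeFn_vecL2 f hf, coeFn_vecL2 g hg] with t ht h1 h2
    rw [EuclideanSpace.norm_eq, EuclideanSpace.norm_eq]
    refine Real.sqrt_le_iff.2 ⟨by positivity, ?_⟩
    rw [mul_pow, Real.sq_sqrt (by positivity), Finset.mul_sum]
    refine Finset.sum_le_sum fun p _ => ?_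
    rw [h1, h2, ← mul_pow]
    exact pow_le_pow_left₀ (norm_nonneg _) (ht p) 2

lemma sqIntegrable_char_smul {f : ℝ → Fin T → ℂ} (hf : SqIntegrable f) (n : ℤ) :
    SqIntegrable fun t => char n t • f t := fun p =>
  (hf p).mul (memLp_top_of_bound (aestronglyMeasurable_char n _) 1
    (.of_forall fun t => (norm_char n t).le))

/-- The function `exp (i n t)` times the `p`-th row of `K`, as an element of the Hilbert space. -/
noncomputable def charRow (K : ℝ → Matrix (Fin T) (Fin T) ℂ) (hK : ∀ p, SqIntegrable fun t => K t p)
    (n : ℤ) (p : Fin T) : VecL2 T :=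
  vecL2 (fun t => char n t • K t p) (sqIntegrable_char_smul (hK p) n)

lemma inner_charRow_left {K : ℝ → Matrix (Fin T) (Fin T) ℂ} (hK : ∀ p, SqIntegrable fun t => K t p)
    (n : ℤ) (p : Fin T) (φ : VecL2 T) : inner ℂ (charRow K hK n p) φ =
      fourierCoef (fun t => (WithLp.ofLp (φ t) ᵥ* (K t)ᴴ) p) n := by
  rw [inner_eq_integral, fourierCoef_eq]
  refine integral_congr_ae ?_
  filter_upwards [coeFn_vecL2 _ (sqIntegrable_char_smul (hK p) n)] with t ht
  rw [charRow, ht, star_smul, star_char, dotProduct_smul, smul_eq_mul]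
  rfl

/-- The Gram matrix of two systems of rows consists of the Fourier coefficients of `K Lᴴ`. -/
lemma inner_charRow_charRow {K L : ℝ → Matrix (Fin T) (Fin T) ℂ}
    (hK : ∀ p, SqIntegrable fun t => K t p)
    (hL : ∀ p, SqIntegrable fun t => L t p) (m n : ℤ) (p q : Fin T) :
    inner ℂ (charRow L hL m q) (charRow K hK n p) =
      fourierCoef (fun t => (K t * (L t)ᴴ) p q) (m - n) := by
  rw [inner_charRow_left, ← fourierCoef_char_mul]
  refine fourierCoef_congr ?_ m
  filter_upwards [coeFn_vecL2 _ (sqIntegrable_char_smul (hK p) n)] with t ht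
  rw [charRow, ht, smul_vecMul]
  rfl

lemma integrable_mul_conjTranspose {K L : ℝ → Matrix (Fin T) (Fin T) ℂ}
    (hK : ∀ p, SqIntegrable fun t => K t p) (hL : ∀ p, SqIntegrable fun t => L t p)
    (p q : Fin T) : Integrable (fun t => (K t * (L t)ᴴ) p q) circleProb :=
  (hK p).integrable_dotProduct_star (hL q)

lemma re_mul_conjTranspose_apply_self (A : Matrix (Fin T) (Fin T) ℂ) (p : Fin T) :
    ((A * Aᴴ) p p).re = ∑ r, ‖A p r‖ ^ 2 := by
  simp only [Matrix.mul_apply, Matrix.conjTranspose_apply, Complex.re_sum, Complex.star_def,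
    Complex.mul_conj, Complex.ofReal_re, Complex.normSq_eq_norm_sq]

lemma sqIntegrable_of_re_le {K V : ℝ → Matrix (Fin T) (Fin T) ℂ}
    (hK : ∀ p q, AEStronglyMeasurable (fun t => K t p q) circleProb)
    (hV : ∀ p q, Integrable (fun t => V t p q) circleProb)
    (h : ∀ᵐ t ∂circleProb, ∀ p, ((K t * (K t)ᴴ) p p).re ≤ (V t p p).re) (p : Fin T) :
    SqIntegrable fun t => K t p := by
  intro r
  rw [memLp_two_iff_integrable_sq_norm (hK p r)]
  refine (hV p p).re.mono' ((hK p r).norm.pow 2) ?_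
  filter_upwards [h] with t ht
  rw [Real.norm_of_nonneg (by positivity)]
  refine le_trans ?_ (ht p)
  rw [re_mul_conjTranspose_apply_self]
  exact Finset.single_le_sum (f := fun r => ‖K t p r‖ ^ 2) (fun _ _ => by positivity)
    (Finset.mem_univ r)

/-! ### Linear combinations -/

/-- The linear combination `∑ n, x(n)ᵀ e(n)`. -/
noncomputable def comb {ι H : Type*} [AddCommGroup H] [Module ℂ H] (e : ι → Fin T → H) :
    (ι →₀ (Fin T → ℂ)) →ₗ[ℂ] H :=
  Finsupp.lsum ℂ fun n => Fintype.linearCombination ℂ (e n)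

lemma comb_apply {ι H : Type*} [AddCommGroup H] [Module ℂ H] (e : ι → Fin T → H)
    (x : ι →₀ (Fin T → ℂ)) : comb e x = x.sum fun n v => ∑ k, v k • e n k := rfl

lemma coeFn_sum_smul_charRow {K : ℝ → Matrix (Fin T) (Fin T) ℂ}
    (hK : ∀ p, SqIntegrable fun t => K t p)
    {ι : Type*} (s : Finset ι) (n : ι → ℤ) (v : ι → Fin T → ℂ) :
    ∀ᵐ t ∂circleProb, WithLp.ofLp ((∑ i ∈ s, ∑ k, v i k • charRow K hK (n i) k : VecL2 T) t) =
      (∑ i ∈ s, char (n i) t • v i) ᵥ* K t := by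
  have h1 := Lp.coeFn_finsetSum s (fun i => (∑ k, v i k • charRow K hK (n i) k : VecL2 T))
  have h2 : ∀ i ∈ s, ∀ᵐ t ∂circleProb, (∑ k, v i k • charRow K hK (n i) k : VecL2 T) t =
      ∑ k, v i k • (charRow K hK (n i) k : VecL2 T) t := by
    intro i _
    have h3 := Lp.coeFn_finsetSum Finset.univ (fun k => (v i k • charRow K hK (n i) k : VecL2 T))
    have h4 : ∀ᵐ t ∂circleProb, ∀ k, (v i k • charRow K hK (n i) k : VecL2 T) t =
        v i k • (charRow K hK (n i) k : VecL2 T) t := by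
      rw [ae_all_iff]
      exact fun k => Lp.coeFn_smul _ _
    filter_upwards [h3, h4] with t h3 h4
    rw [h3, Finset.sum_apply]
    exact Finset.sum_congr rfl fun k _ => h4 k
  have h5 : ∀ i ∈ s, ∀ᵐ t ∂circleProb, ∀ k,
      WithLp.ofLp ((charRow K hK (n i) k : VecL2 T) t) = char (n i) t • K t k := by
    intro i _
    rw [ae_all_iff]
    exact fun k => coeFn_vecL2 _ _
  have h2' := (Finset.eventually_all s).2 h2
  have h5' := (Finset.eventually_all s).2 h5
  filter_upwards [h1, h2', h5'] with t h1 h2 h5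
  rw [h1, Finset.sum_apply, WithLp.ofLp_sum, Matrix.sum_vecMul]
  refine Finset.sum_congr rfl fun i hi => ?_
  rw [h2 i hi, WithLp.ofLp_sum, smul_vecMul, vecMul_eq_sum, Finset.smul_sum]
  refine Finset.sum_congr rfl fun k _ => ?_
  rw [WithLp.ofLp_smul, h5 i hi k, smul_comm]

lemma coeFn_comb_charRow {K : ℝ → Matrix (Fin T) (Fin T) ℂ} (hK : ∀ p, SqIntegrable fun t => K t p)
    (x : ℤ →₀ (Fin T → ℂ)) :
    ∀ᵐ t ∂circleProb, WithLp.ofLp (comb (charRow K hK) x t) = trigPoly x t ᵥ* K t :=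
  coeFn_sum_smul_charRow hK x.support id x

lemma sqIntegrable_vecMul {K : ℝ → Matrix (Fin T) (Fin T) ℂ} (hK : ∀ p, SqIntegrable fun t => K t p)
    {f : ℝ → Fin T → ℂ} (hf : ∀ k, AEStronglyMeasurable (fun t => f t k) circleProb) {M : ℝ}
    (hM : ∀ t k, ‖f t k‖ ≤ M) : SqIntegrable fun t => f t ᵥ* K t := by
  intro p
  have : MemLp (fun t => ∑ k, f t k * K t k p) 2 circleProb := memLp_finsetSum _ fun k _ =>
    (hK k p).mul (memLp_top_of_bound (hf k) M (.of_forall fun t => hM t k))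
  exact this

lemma norm_vecMul_le {K : ℝ → Matrix (Fin T) (Fin T) ℂ} (hK : ∀ p, SqIntegrable fun t => K t p)
    {f : ℝ → Fin T → ℂ} (hf : ∀ k, AEStronglyMeasurable (fun t => f t k) circleProb) {M : ℝ}
    (hM : ∀ t k, ‖f t k‖ ≤ M) :
    ‖vecL2 _ (sqIntegrable_vecMul hK hf hM)‖ ≤ M * ∑ k, ‖charRow K hK 0 k‖ := by
  have hk (k : Fin T) : SqIntegrable fun t => f t k • K t k := fun p =>
    (hK k p).mul (memLp_top_of_bound (hf k) M (.of_forall fun t => hM t k))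
  have hsum : vecL2 _ (sqIntegrable_vecMul hK hf hM) = ∑ k, vecL2 _ (hk k) := by
    symm
    refine eq_vecL2 _ ?_
    have h1 := Lp.coeFn_finsetSum Finset.univ (fun k => vecL2 _ (hk k))
    have h2 : ∀ᵐ t ∂circleProb, ∀ k, WithLp.ofLp (vecL2 _ (hk k) t) = f t k • K t k := by
      rw [ae_all_iff]
      exact fun k => coeFn_vecL2 _ _
    filter_upwards [h1, h2] with t h1 h2
    rw [h1, Finset.sum_apply, WithLp.ofLp_sum, vecMul_eq_sum]
    exact Finset.sum_congr rfl fun k _ => h2 k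
  rw [hsum, Finset.mul_sum]
  refine (norm_sum_le _ _).trans (Finset.sum_le_sum fun k _ => ?_)
  refine norm_vecL2_le _ _ (.of_forall fun t p => ?_)
  rw [char_zero, one_smul, Pi.smul_apply, norm_smul]
  gcongr
  exact hM t k

/-- The symbol `A(exp (i t))` acts on the rows of `K` termwise. -/
theorem hasSum_charRow_functionalSymbol {K : ℝ → Matrix (Fin T) (Fin T) ℂ}
    (hK : ∀ p, SqIntegrable fun t => K t p) {Z : Set ℤ} {a : ℤ → Fin T → ℂ}
    (ha : Summable fun j : Z => ∑ k, ‖a j k‖) :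
    ∃ h : SqIntegrable fun t => functionalSymbol Z a t ᵥ* K t,
      HasSum (fun j : Z => ∑ k, a j k • charRow K hK (-(j : ℤ)) k) (vecL2 _ h) := by
  have hle (j : Z) (k : Fin T) (t : ℝ) : ‖(char (-(j : ℤ)) t • a j) k‖ ≤ ∑ k, ‖a j k‖ := by
    rw [Pi.smul_apply, norm_smul, norm_char, one_mul]
    exact Finset.single_le_sum (f := fun k => ‖a j k‖) (fun _ _ => norm_nonneg _)
      (Finset.mem_univ k)
  have hsumm (t : ℝ) : Summable fun j : Z => char (-(j : ℤ)) t • a j := by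
    rw [Pi.summable]
    exact fun k => Summable.of_norm_bounded ha fun j => hle j k t
  have happ (t : ℝ) (k : Fin T) :
      functionalSymbol Z a t k = ∑' j : Z, (char (-(j : ℤ)) t • a j) k :=
    tsum_apply (hsumm t)
  have hcont (k : Fin T) : Continuous fun t => functionalSymbol Z a t k := by
    simp only [happ]
    exact continuous_tsum (fun j => by
      simp only [Pi.smul_apply]
      exact (continuous_char _).smul continuous_const) ha fun j t => hle j k t
  have hbd (t : ℝ) (k : Fin T) : ‖functionalSymbol Z a t k‖ ≤ ∑' j : Z, ∑ k, ‖a j k‖ := by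
    rw [happ]
    exact tsum_of_norm_bounded ha.hasSum fun j => hle j k t
  refine ⟨sqIntegrable_vecMul hK (fun k => (hcont k).aestronglyMeasurable) hbd, ?_⟩
  -- the remainder after the terms `j ∈ s` is bounded by the tail of the series of the norms
  let r (s : Finset Z) (t : ℝ) : Fin T → ℂ :=
    functionalSymbol Z a t - ∑ j ∈ s, char (-(j : ℤ)) t • a j
  have hr (s : Finset Z) (t : ℝ) (k : Fin T) :
      ‖r s t k‖ ≤ ∑' j : {j // j ∉ s}, ∑ k, ‖a (j : Z) k‖ := by
    have h1 : r s t k = ∑' j : {j // j ∉ s}, (char (-((j : Z) : ℤ)) t • a (j : Z)) k := by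
      have h2 := ((Pi.summable.1 (hsumm t)) k).sum_add_tsum_subtype_compl s
      simp only [r, Pi.sub_apply, happ, Finset.sum_apply, ← h2, add_sub_cancel_left]
    rw [h1]
    exact tsum_of_norm_bounded (ha.subtype _).hasSum fun j => hle j k t
  have hrm (s : Finset Z) (k : Fin T) : AEStronglyMeasurable (fun t => r s t k) circleProb := by
    refine Continuous.aestronglyMeasurable ?_
    simp only [r, Pi.sub_apply, Finset.sum_apply, Pi.smul_apply]
    exact (hcont k).sub (continuous_finsetSum _ fun j _ =>
      (continuous_char _).smul continuous_const)
  have hdiff (s : Finset Z) : vecL2 _ (sqIntegrable_vecMul hK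
      (fun k => (hcont k).aestronglyMeasurable) hbd) -
        ∑ j ∈ s, ∑ k, a j k • charRow K hK (-(j : ℤ)) k =
      vecL2 _ (sqIntegrable_vecMul hK (hrm s) (hr s)) := by
    refine eq_vecL2 _ ?_
    filter_upwards [Lp.coeFn_sub (vecL2 _ (sqIntegrable_vecMul hK
      (fun k => (hcont k).aestronglyMeasurable) hbd))
        (∑ j ∈ s, ∑ k, a j k • charRow K hK (-(j : ℤ)) k : VecL2 T),
      coeFn_vecL2 _ (sqIntegrable_vecMul hK (fun k => (hcont k).aestronglyMeasurable) hbd),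
      coeFn_sum_smul_charRow hK s (fun j => -(j : ℤ)) (fun j => a j)] with t h1 h2 h3
    rw [h1, Pi.sub_apply, WithLp.ofLp_sub, h2, h3, ← Matrix.sub_vecMul]
  rw [HasSum, SummationFilter.unconditional_filter, tendsto_iff_norm_sub_tendsto_zero]
  have htail := (tendsto_tsum_compl_atTop_zero fun j : Z => ∑ k, ‖a j k‖).mul_const
    (∑ k, ‖charRow K hK 0 k‖)
  rw [zero_mul] at htail
  refine squeeze_zero (fun _ => norm_nonneg _) (fun s => ?_) htail
  rw [norm_sub_rev, hdiff]
  exact norm_vecMul_le hK (hrm s) (hr s)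

/-! ### Weighted norms -/

lemma re_quadratic_eq {K V : Matrix (Fin T) (Fin T) ℂ} (hV : K * Kᴴ = V)
    (f : Fin T → ℂ) : (f ⬝ᵥ (V *ᵥ star f)).re = ∑ p, ‖(f ᵥ* K) p‖ ^ 2 := by
  have h : f ⬝ᵥ (V *ᵥ star f) = (f ᵥ* K) ⬝ᵥ star (f ᵥ* K) := by
    rw [← hV, ← mulVec_mulVec, dotProduct_mulVec, star_vecMul]
  rw [h, dotProduct, Complex.re_sum]
  refine Finset.sum_congr rfl fun p _ => ?_
  rw [Pi.star_apply, Complex.star_def, Complex.mul_conj, Complex.ofReal_re,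
    Complex.normSq_eq_norm_sq]

lemma weightedNormSq_eq_lintegral (V : ℝ → Matrix (Fin T) (Fin T) ℂ) (f : ℝ → Fin T → ℂ) :
    weightedNormSq V f =
      ∫⁻ t, ENNReal.ofReal (f t ⬝ᵥ (V t *ᵥ star (f t))).re ∂circleProb := by
  rw [circleProb, lintegral_smul_measure]; rfl

/-- If `V = K Kᴴ`, the norm of `f` in `L₂(V)` is the norm of `fᵀ K` in the unweighted space. -/
theorem weightedNormSq_eq_norm_sq {K V : ℝ → Matrix (Fin T) (Fin T) ℂ}
    (hV : ∀ᵐ t ∂circleProb, K t * (K t)ᴴ = V t) {f : ℝ → Fin T → ℂ} {φ : VecL2 T}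
    (hφ : ∀ᵐ t ∂circleProb, WithLp.ofLp (φ t) = f t ᵥ* K t) :
    weightedNormSq V f = ENNReal.ofReal (‖φ‖ ^ 2) := by
  rw [weightedNormSq_eq_lintegral, norm_sq_eq_integral, ofReal_integral_eq_lintegral_ofReal
    (Lp.memLp φ).norm.integrable_sq (.of_forall fun t => by positivity)]
  refine lintegral_congr_ae ?_
  filter_upwards [hV, hφ] with t h2 h3
  rw [re_quadratic_eq h2, EuclideanSpace.norm_sq_eq, h3]

lemma MemWeighted.sqIntegrable {K V : ℝ → Matrix (Fin T) (Fin T) ℂ}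
    (hK : ∀ p q, AEStronglyMeasurable (fun t => K t p q) circleProb)
    (hV : ∀ᵐ t ∂circleProb, K t * (K t)ᴴ = V t) {f : ℝ → Fin T → ℂ} (hf : MemWeighted V f) :
    SqIntegrable fun t => f t ᵥ* K t := by
  intro p
  have hm : AEStronglyMeasurable (fun t => ∑ k, f t k * K t k p) circleProb :=
    Finset.aestronglyMeasurable_fun_sum _ fun k _ =>
      (aestronglyMeasurable_circleProb.2 (hf.1 k)).mul (hK k p)
  refine ⟨hm, ?_⟩
  rw [eLpNorm_lt_top_iff_lintegral_rpow_enorm_lt_top two_ne_zero ENNReal.ofNat_ne_top]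
  refine lt_of_le_of_lt ?_ hf.2
  rw [weightedNormSq_eq_lintegral]
  refine lintegral_mono_ae ?_
  filter_upwards [hV] with t ht
  rw [re_quadratic_eq ht, ENNReal.toReal_ofNat, ← ofReal_norm,
    ENNReal.ofReal_rpow_of_nonneg (norm_nonneg _) zero_le_two, Real.rpow_two]
  exact ENNReal.ofReal_le_ofReal (Finset.single_le_sum (f := fun p => ‖(f t ᵥ* K t) p‖ ^ 2)
    (fun _ _ => by positivity) (Finset.mem_univ p))

/-! ### Completeness of the rows of a weight and its inverse -/

/-- If `φ` is orthogonal to the rows of `exp (i n t) S` for `n ∉ U` and to the rows of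
`exp (i n t) S⁻¹` for `n ∈ U`, where `U` contains all `n ≥ 0` and only finitely many `n < 0`,
then `φ = 0`. The vectors `f = φ S` and `g = φ S⁻¹` are integrable with Fourier
coefficients supported in `U` and in its complement, and `fᵀ conj g = |φ|²`; after the removal of
the finitely many frequencies of `U` below zero from `f` (which are orthogonal to `g`) both `f` and
`conj g` are of Hardy type, so that the integral of `|φ|²` vanishes. -/
theorem eq_zero_of_inner_charRow_eq_zero {S D : ℝ → Matrix (Fin T) (Fin T) ℂ}
    (hS : ∀ p, SqIntegrable fun t => S t p) (hD : ∀ p, SqIntegrable fun t => D t p)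
    (hSD : ∀ᵐ t ∂circleProb, (S t)ᴴ * D t = 1) {U : Set ℤ}
    (hU : ∀ n : ℤ, 0 ≤ n → n ∈ U) (hfin : (U ∩ {n | n < 0}).Finite) {φ : VecL2 T}
    (h1 : ∀ n ∉ U, ∀ p, inner ℂ (charRow S hS n p) φ = 0)
    (h2 : ∀ n ∈ U, ∀ p, inner ℂ (charRow D hD n p) φ = 0) : φ = 0 := by
  set f : Fin T → ℝ → ℂ := fun p t => (WithLp.ofLp (φ t) ᵥ* (S t)ᴴ) p with hf
  set g : Fin T → ℝ → ℂ := fun p t => (WithLp.ofLp (φ t) ᵥ* (D t)ᴴ) p with hg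
  have hfi (p) : Integrable (f p) circleProb :=
    (sqIntegrable_coeFn φ).integrable_dotProduct_star (hS p)
  have hgi (p) : Integrable (g p) circleProb :=
    (sqIntegrable_coeFn φ).integrable_dotProduct_star (hD p)
  have hf1 (p n) (hn : n ∉ U) : fourierCoef (f p) n = 0 := by
    rw [← h1 n hn p, inner_charRow_left]
  have hg1 (p n) (hn : n ∈ U) : fourierCoef (g p) n = 0 := by
    rw [← h2 n hn p, inner_charRow_left]
  have hfg : ∀ᵐ t ∂circleProb, ∑ p, f p t * star (g p t) =
      WithLp.ofLp (φ t) ⬝ᵥ star (WithLp.ofLp (φ t)) := by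
    filter_upwards [hSD] with t ht
    change (WithLp.ofLp (φ t) ᵥ* (S t)ᴴ) ⬝ᵥ star (WithLp.ofLp (φ t) ᵥ* (D t)ᴴ) = _
    rw [star_vecMul, conjTranspose_conjTranspose, ← dotProduct_mulVec, mulVec_mulVec, ht,
      one_mulVec]
  have hφi : Integrable (fun t => WithLp.ofLp (φ t) ⬝ᵥ star (WithLp.ofLp (φ t))) circleProb :=
    (sqIntegrable_coeFn φ).integrable_dotProduct_star (sqIntegrable_coeFn φ)
  -- the part of `f` with negative frequencies
  let w : Fin T → ℝ → ℂ := fun p t => ∑ n ∈ hfin.toFinset, char n t * fourierCoef (f p) n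
  have hwc (p) : Continuous (w p) := continuous_finsetSum _ fun n _ =>
    (continuous_char n).mul continuous_const
  have hwb (p t) : ‖w p t‖ ≤ ∑ n ∈ hfin.toFinset, ‖fourierCoef (f p) n‖ :=
    (norm_sum_le _ _).trans_eq (Finset.sum_congr rfl fun n _ => by
      rw [norm_mul, norm_char, one_mul])
  have hwi (p) : Integrable (w p) circleProb :=
    .of_bound (hwc p).aestronglyMeasurable _ (.of_forall (hwb p))
  have hgs (p) : Integrable (fun t => star (g p t)) circleProb :=
    (LinearIsometryEquiv.integrable_comp_iff (Complex.conjLIE)).2 (hgi p)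
  have hwgi (p) : Integrable (fun t => w p t * star (g p t)) circleProb :=
    (hgs p).bdd_mul (hwc p).aestronglyMeasurable (.of_forall (hwb p))
  have hwg (p) : ∫ t, w p t * star (g p t) ∂circleProb = 0 := by
    simp only [w, Finset.sum_mul]
    rw [integral_finsetSum]
    · refine Finset.sum_eq_zero fun n hn => ?_
      have h3 : ∫ t, char n t * star (g p t) ∂circleProb = 0 := by
        have := fourierCoef_star (g p) (-n)
        rw [neg_neg, hg1 p n (hfin.mem_toFinset.1 hn).1, fourierCoef_eq, neg_neg, star_zero] at this
        exact this
      calc ∫ t, char n t * fourierCoef (f p) n * star (g p t) ∂circleProb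
          = ∫ t, fourierCoef (f p) n * (char n t * star (g p t)) ∂circleProb := by
            congr 1; ext t; ring
        _ = 0 := by rw [integral_const_mul, h3, mul_zero]
    · intro n _
      have := (integrable_char_mul (hgs p) n).const_mul (fourierCoef (f p) n)
      refine this.congr (.of_forall fun t => ?_)
      ring
  have hw1 (p) (m : ℤ) : fourierCoef (w p) m =
      if m ∈ hfin.toFinset then fourierCoef (f p) m else 0 := by
    simp only [w]
    rw [fourierCoef_sum]
    · simp only [mul_comm (char _ _), fourierCoef_const_mul]
      simp [fourierCoef_char]
    · exact fun n _ => integrable_char_mul (integrable_const _) n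
  have key := integral_sum_mul_of_fourierCoef_eq_zero (f := fun p t => f p t - w p t)
    (g := fun p t => star (g p t)) (fun p => (hfi p).sub (hwi p)) hgs
    (fun p n hn => by
      rw [fourierCoef_sub (hfi p) (hwi p), hw1]
      split_ifs with h
      · rw [sub_self]
      · rw [hf1 p n (fun hnU => h (hfin.mem_toFinset.2 ⟨hnU, hn⟩)), sub_zero])
    (fun p n hn => by
      rw [fourierCoef_star, hg1 p (-n) (hU _ (by omega)), star_zero])
    (by
      have : Integrable (fun t => ∑ p, f p t * star (g p t) - ∑ p, w p t * star (g p t))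
          circleProb :=
        (hφi.congr (hfg.mono fun t ht => ht.symm)).sub (integrable_finsetSum _ fun p _ => hwgi p)
      refine this.congr (.of_forall fun t => ?_)
      simp only [sub_mul, Finset.sum_sub_distrib])
  have hzero : ∫ t, ∑ p, f p t * star (g p t) ∂circleProb = 0 := by
    have h0 : ∑ p, fourierCoef (fun t => f p t - w p t) 0 * fourierCoef (fun t => star (g p t)) 0
        = 0 := Finset.sum_eq_zero fun p _ => by
      rw [fourierCoef_star, neg_zero, hg1 p 0 (hU 0 le_rfl), star_zero, mul_zero]
    rw [h0] at key
    simp only [sub_mul, Finset.sum_sub_distrib] at key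
    rw [integral_sub (hφi.congr (hfg.mono fun t ht => ht.symm))
      (integrable_finsetSum _ fun p _ => hwgi p),
      integral_finsetSum _ fun p _ => hwgi p] at key
    rw [Finset.sum_eq_zero fun p _ => hwg p, sub_zero] at key
    exact key
  rw [← inner_self_eq_zero (𝕜 := ℂ), inner_eq_integral, ← hzero]
  exact integral_congr_ae (hfg.mono fun t ht => ht.symm)

/-! ### Gram matrices and their inverses in a Hilbert space -/

section Hilbert

variable {ι H H' : Type*} [NormedAddCommGroup H] [InnerProductSpace ℂ H]
  [NormedAddCommGroup H'] [InnerProductSpace ℂ H']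

lemma inner_comb_right (e : ι → Fin T → H) (φ : H) (x : ι →₀ (Fin T → ℂ)) :
    inner ℂ φ (comb e x) = x.sum fun n v => ∑ k, v k * inner ℂ φ (e n k) := by
  simp only [comb_apply, Finsupp.sum, inner_sum, inner_smul_right]

lemma inner_comb_left (e : ι → Fin T → H) (φ : H) (x : ι →₀ (Fin T → ℂ)) :
    inner ℂ (comb e x) φ = x.sum fun n v => ∑ k, star (v k) * inner ℂ (e n k) φ := by
  simp only [comb_apply, Finsupp.sum, sum_inner, inner_smul_left, Complex.star_def]

lemma inner_comb_congr {e : ι → Fin T → H} {ζ : ι → Fin T → H'} {φ : H} {Y : H'}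
    (h : ∀ n p, inner ℂ φ (e n p) = inner ℂ Y (ζ n p)) (x : ι →₀ (Fin T → ℂ)) :
    inner ℂ φ (comb e x) = inner ℂ Y (comb ζ x) := by
  simp only [inner_comb_right, h]

lemma norm_comb_congr {e : ι → Fin T → H} {ζ : ι → Fin T → H'}
    (h : ∀ m q n p, inner ℂ (e m q) (e n p) = inner ℂ (ζ m q) (ζ n p)) (x : ι →₀ (Fin T → ℂ)) :
    ‖comb e x‖ = ‖comb ζ x‖ := by
  have h1 : inner ℂ (comb e x) (comb e x) = inner ℂ (comb ζ x) (comb ζ x) := by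
    refine inner_comb_congr (fun n p => ?_) x
    rw [← inner_conj_symm, inner_comb_congr (h n p) x, inner_conj_symm]
  rw [← sq_eq_sq₀ (norm_nonneg _) (norm_nonneg _), ← inner_self_eq_norm_sq (𝕜 := ℂ), h1,
    inner_self_eq_norm_sq]

/-- The linear span of the vectors `e j k`, `j ∈ O`. -/
def spanOn (e : ι → Fin T → H) (O : Set ι) : Submodule ℂ H :=
  Submodule.span ℂ {X | ∃ j ∈ O, ∃ k, X = e j k}

lemma comb_mem_spanOn (e : ι → Fin T → H) {O : Set ι} {x : ι →₀ (Fin T → ℂ)}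
    (hx : (x.support : Set ι) ⊆ O) : comb e x ∈ spanOn e O := by
  simp only [comb_apply, Finsupp.sum]
  refine Submodule.sum_mem _ fun n hn => Submodule.sum_mem _ fun k _ => ?_
  exact Submodule.smul_mem _ _ (Submodule.subset_span ⟨n, hx hn, k, rfl⟩)

lemma exists_comb_eq (e : ι → Fin T → H) {O : Set ι} {φ : H} (hφ : φ ∈ spanOn e O) :
    ∃ x : ι →₀ (Fin T → ℂ), (x.support : Set ι) ⊆ O ∧ comb e x = φ := by
  classical
  induction hφ using Submodule.span_induction with
  | mem y hy =>
    obtain ⟨j, hj, k, rfl⟩ := hy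
    refine ⟨Finsupp.single j (Pi.single k 1), ?_, ?_⟩
    · exact (Finset.coe_subset.2 Finsupp.support_single_subset).trans (by simpa using hj)
    · rw [comb_apply, Finsupp.sum_single_index (by simp)]
      simp [Pi.single_apply]
  | zero => exact ⟨0, by simp, by simp⟩
  | add y z _ _ hy hz =>
    obtain ⟨x, hx, rfl⟩ := hy
    obtain ⟨x', hx', rfl⟩ := hz
    refine ⟨x + x', ?_, map_add _ _ _⟩
    refine (Finset.coe_subset.2 Finsupp.support_add).trans ?_
    rw [Finset.coe_union]
    exact Set.union_subset hx hx'
  | smul c y _ hy =>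
    obtain ⟨x, hx, rfl⟩ := hy
    exact ⟨c • x, (Finset.coe_subset.2 Finsupp.support_smul).trans hx, map_smul _ _ _⟩

lemma exists_tendsto_comb (e : ι → Fin T → H) {O : Set ι} {φ : H}
    (hφ : φ ∈ (spanOn e O).topologicalClosure) :
    ∃ x : ℕ → (ι →₀ (Fin T → ℂ)), (∀ n, ((x n).support : Set ι) ⊆ O) ∧
      Tendsto (fun n => comb e (x n)) atTop (𝓝 φ) := by
  rw [← SetLike.mem_coe, Submodule.topologicalClosure_coe] at hφ
  obtain ⟨u, hu, hlim⟩ := mem_closure_iff_seq_limit.1 hφ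
  choose x hx hxu using fun n => exists_comb_eq e (hu n)
  exact ⟨x, hx, hlim.congr fun n => (hxu n).symm⟩

lemma inner_eq_zero_of_mem_closure {e : ι → Fin T → H} {O : Set ι} {φ ψ : H}
    (h : ∀ n ∈ O, ∀ p, inner ℂ (e n p) φ = 0) (hψ : ψ ∈ (spanOn e O).topologicalClosure) :
    inner ℂ ψ φ = 0 := by
  have h1 : (spanOn e O).topologicalClosure ≤ (Submodule.span ℂ {φ})ᗮ := by
    refine Submodule.topologicalClosure_minimal _ ?_ (Submodule.isClosed_orthogonal _)
    refine Submodule.span_le.2 ?_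
    rintro _ ⟨n, hn, p, rfl⟩
    rw [SetLike.mem_coe, Submodule.mem_orthogonal_singleton_iff_inner_left]
    exact h n hn p
  exact Submodule.mem_orthogonal_singleton_iff_inner_left.1 (h1 hψ)

variable {d e : ι → Fin T → H} {K : ι → ι → Matrix (Fin T) (Fin T) ℂ}

lemma applyFin_eq_inner (hK : ∀ k j p q, K k j p q = inner ℂ (d k q) (d j p))
    (x : ι →₀ (Fin T → ℂ)) (k : ι) (q : Fin T) :
    applyFin K x k q = inner ℂ (d k q) (comb d x) := by
  simp only [applyFin, inner_comb_right, Finsupp.sum, Finset.sum_apply, vecMul, dotProduct, hK]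

lemma pairFin_eq_inner {y : ι → Fin T → ℂ} {φ : H} (hy : ∀ k q, y k q = inner ℂ (d k q) φ)
    (x : ι →₀ (Fin T → ℂ)) : pairFin y x = inner ℂ (comb d x) φ := by
  simp only [pairFin, inner_comb_left, dotProduct, hy, Pi.star_apply, mul_comm]

lemma pairFin_applyFin (hK : ∀ k j p q, K k j p q = inner ℂ (d k q) (d j p))
    (x : ι →₀ (Fin T → ℂ)) : pairFin (applyFin K x) x = ((‖comb d x‖ ^ 2 : ℝ) : ℂ) := by
  rw [pairFin_eq_inner (applyFin_eq_inner hK x), inner_self_eq_norm_sq_to_K]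
  norm_cast

lemma inner_comb_of_biorthogonal [DecidableEq ι]
    (hed : ∀ k q j p, inner ℂ (e k q) (d j p) = if k = j ∧ q = p then 1 else 0)
    (x : ι →₀ (Fin T → ℂ)) (k : ι) (q : Fin T) : inner ℂ (e k q) (comb d x) = x k q := by
  rw [inner_comb_right, Finsupp.sum, Finset.sum_eq_single k]
  · simp [hed]
  · intro b _ hb
    simp [hed, Ne.symm hb]
  · intro h
    simp [Finsupp.notMem_support_iff.1 h]

/-- The solution of `K c = y` for a Gram matrix `K` of vectors `d` with the biorthogonal system `e`:
if `φ` is a limit of linear combinations of the `d k` and `y = ⟨d, φ⟩`, then `c = ⟨e, φ⟩` consists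
of the coordinates of `φ` and `⟨y, c⟩ = ‖φ‖²`. -/
theorem isInverseImage_of_mem_closure [DecidableEq ι]
    (hK : ∀ k j p q, K k j p q = inner ℂ (d k q) (d j p))
    (hed : ∀ k q j p, inner ℂ (e k q) (d j p) = if k = j ∧ q = p then 1 else 0)
    {φ : H} (hφ : φ ∈ (spanOn d Set.univ).topologicalClosure) {y c : ι → Fin T → ℂ}
    (hy : ∀ k q, y k q = inner ℂ (d k q) φ) (hc : ∀ k q, c k q = inner ℂ (e k q) φ) :
    IsInverseImage K y c ((‖φ‖ ^ 2 : ℝ) : ℂ) := by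
  obtain ⟨x, -, hx⟩ := exists_tendsto_comb d hφ
  refine ⟨x, fun ε hε => ?_, fun k => ?_, fun k => ?_, ?_⟩
  · obtain ⟨n₀, hn₀⟩ := Metric.cauchySeq_iff.1 hx.cauchySeq (Real.sqrt ε) (Real.sqrt_pos.2 hε)
    refine ⟨n₀, fun m hm n hn => ?_⟩
    rw [pairFin_applyFin hK, map_sub, ← dist_eq_norm, Complex.norm_real,
      Real.norm_of_nonneg (by positivity)]
    exact (Real.lt_sqrt dist_nonneg).1 (hn₀ m hm n hn)
  · rw [tendsto_pi_nhds]
    intro q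
    simp only [applyFin_eq_inner hK, hy]
    exact tendsto_const_nhds.inner hx
  · rw [tendsto_pi_nhds]
    intro q
    simp only [← inner_comb_of_biorthogonal hed, hc]
    exact tendsto_const_nhds.inner hx
  · simp only [pairFin_eq_inner hy]
    have h1 : ((‖φ‖ ^ 2 : ℝ) : ℂ) = inner ℂ φ φ := by
      rw [inner_self_eq_norm_sq_to_K]; norm_cast
    rw [h1]
    exact hx.inner tendsto_const_nhds

/-- Uniqueness of the solution: a Cauchy sequence for the form of `K` converges, in the completion,
to the only element of the closed span of the `d k` with the given inner products `y`. -/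
theorem IsInverseImage.eq_of_mem_closure [CompleteSpace H] [DecidableEq ι]
    (hK : ∀ k j p q, K k j p q = inner ℂ (d k q) (d j p))
    (hed : ∀ k q j p, inner ℂ (e k q) (d j p) = if k = j ∧ q = p then 1 else 0)
    {φ : H} (hφ : φ ∈ (spanOn d Set.univ).topologicalClosure) {y c : ι → Fin T → ℂ}
    (hy : ∀ k q, y k q = inner ℂ (d k q) φ) (hc : ∀ k q, c k q = inner ℂ (e k q) φ)
    {c' : ι → Fin T → ℂ} {q' : ℂ} (h : IsInverseImage K y c' q') :
    c' = c ∧ q' = ((‖φ‖ ^ 2 : ℝ) : ℂ) := by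
  obtain ⟨x, hcau, hKx, hxc, hxq⟩ := h
  have hC : CauchySeq fun n => comb d (x n) := by
    refine Metric.cauchySeq_iff.2 fun ε hε => ?_
    obtain ⟨n₀, hn₀⟩ := hcau (ε ^ 2) (by positivity)
    refine ⟨n₀, fun m hm n hn => ?_⟩
    have := hn₀ m hm n hn
    rw [pairFin_applyFin hK, map_sub, Complex.norm_real,
      Real.norm_of_nonneg (by positivity)] at this
    rw [dist_eq_norm]
    exact lt_of_pow_lt_pow_left₀ 2 hε.le this
  obtain ⟨φ', hφ'⟩ := cauchySeq_tendsto_of_complete hC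
  have hmem : φ' ∈ (spanOn d Set.univ).topologicalClosure := by
    refine (Submodule.isClosed_topologicalClosure _).mem_of_tendsto hφ' (.of_forall fun n => ?_)
    exact Submodule.le_topologicalClosure _ (comb_mem_spanOn d (Set.subset_univ _))
  have heq : φ' = φ := by
    rw [← sub_eq_zero, ← inner_self_eq_zero (𝕜 := ℂ)]
    refine inner_eq_zero_of_mem_closure (e := d) (O := Set.univ) (fun k _ q => ?_)
      (Submodule.sub_mem _ hmem hφ)
    rw [inner_sub_right, ← hy, sub_eq_zero]
    refine tendsto_nhds_unique (tendsto_const_nhds.inner hφ') ?_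
    simpa only [applyFin_eq_inner hK] using (tendsto_pi_nhds.1 (hKx k)) q
  rw [heq] at hφ'
  constructor
  · ext k q
    refine tendsto_nhds_unique ((tendsto_pi_nhds.1 (hxc k)) q) ?_
    simp only [← inner_comb_of_biorthogonal hed, hc]
    exact tendsto_const_nhds.inner hφ'
  · refine tendsto_nhds_unique hxq ?_
    simp only [pairFin_eq_inner hy]
    have h1 : ((‖φ‖ ^ 2 : ℝ) : ℂ) = inner ℂ φ φ := by
      rw [inner_self_eq_norm_sq_to_K]; norm_cast
    rw [h1]
    exact hφ'.inner tendsto_const_nhds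

end Hilbert

/-! ### Gram matrices that are bounded and boundedly invertible in `ℓ₂` -/

section Bounded

variable {U : Set ℤ} {H : Type*} [NormedAddCommGroup H] [InnerProductSpace ℂ H]

/-- A finitely supported sequence as an element of `ℓ₂`. -/
noncomputable def toSeq (x : U →₀ (Fin T → ℂ)) : SeqSpace T U :=
  ⟨fun k => WithLp.toLp 2 (x k), memℓp_gen <| summable_of_hasFiniteSupport <|
    x.hasFiniteSupport.subset fun k hk => by
      contrapose! hk
      have : x k = 0 := by simpa using hk
      simp [this]⟩

lemma toSeq_apply (x : U →₀ (Fin T → ℂ)) (k : U) : WithLp.ofLp (toSeq x k) = x k := rfl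

lemma inner_toSeq_left (x : U →₀ (Fin T → ℂ)) (y : SeqSpace T U) :
    inner ℂ (toSeq x) y = pairFin (fun k => WithLp.ofLp (y k)) x := by
  refine (lp.hasSum_inner (toSeq x) y).unique ?_
  rw [pairFin, Finsupp.sum]
  refine hasSum_sum_of_ne_finset_zero fun k hk => ?_
  have : toSeq x k = 0 := by
    refine WithLp.ofLp_injective 2 ?_
    rw [toSeq_apply, Finsupp.notMem_support_iff.1 hk]; rfl
  rw [this, inner_zero_left]

variable {d e : U → Fin T → H} {K : U → U → Matrix (Fin T) (Fin T) ℂ}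

lemma HasBlockMatrix.apply_toSeq {B : SeqSpace T U → SeqSpace T U} (hB : HasBlockMatrix B K)
    (x : U →₀ (Fin T → ℂ)) (k : U) : WithLp.ofLp (B (toSeq x) k) = applyFin K x k := by
  refine (hB (toSeq x) k).unique ?_
  rw [applyFin, Finsupp.sum]
  refine hasSum_sum_of_ne_finset_zero fun j hj => ?_
  rw [toSeq_apply, Finsupp.notMem_support_iff.1 hj, zero_vecMul]

lemma norm_comb_sq_le {B : SeqSpace T U →L[ℂ] SeqSpace T U} (hB : HasBlockMatrix B K)
    (hK : ∀ k j p q, K k j p q = inner ℂ (d k q) (d j p)) (x : U →₀ (Fin T → ℂ)) :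
    ‖comb d x‖ ^ 2 ≤ ‖B‖ * ‖toSeq x‖ ^ 2 := by
  have h1 : inner ℂ (toSeq x) (B (toSeq x)) = ((‖comb d x‖ ^ 2 : ℝ) : ℂ) := by
    rw [inner_toSeq_left, ← pairFin_applyFin hK]
    simp only [hB.apply_toSeq]
  have h2 : ‖comb d x‖ ^ 2 = ‖(inner ℂ (toSeq x) (B (toSeq x)) : ℂ)‖ := by
    rw [h1, Complex.norm_real, Real.norm_of_nonneg (by positivity)]
  rw [h2]
  calc _ ≤ ‖toSeq x‖ * ‖B (toSeq x)‖ := norm_inner_le_norm _ _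
    _ ≤ ‖toSeq x‖ * (‖B‖ * ‖toSeq x‖) := by gcongr; exact B.le_opNorm _
    _ = _ := by ring

/-- The Bessel inequality for vectors `d` whose Gram matrix is bounded in `ℓ₂`. -/
lemma sum_norm_inner_sq_le {B : SeqSpace T U →L[ℂ] SeqSpace T U} (hB : HasBlockMatrix B K)
    (hK : ∀ k j p q, K k j p q = inner ℂ (d k q) (d j p)) (ψ : H) (s : Finset U) :
    ∑ k ∈ s, ‖(WithLp.toLp 2 fun q => inner ℂ (d k q) ψ : EuclideanSpace ℂ (Fin T))‖ ^ 2 ≤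
      ‖B‖ * ‖ψ‖ ^ 2 := by
  classical
  set A := ∑ k ∈ s, ‖(WithLp.toLp 2 fun q => inner ℂ (d k q) ψ : EuclideanSpace ℂ (Fin T))‖ ^ 2
    with hA
  have hA0 : 0 ≤ A := Finset.sum_nonneg fun _ _ => by positivity
  let x : U →₀ (Fin T → ℂ) := Finsupp.onFinset s
    (fun k => if k ∈ s then fun q => inner ℂ (d k q) ψ else 0) fun k hk => by
      by_contra h
      exact hk (if_neg h)
  have hxs (k) (hk : k ∈ s) : x k = fun q => inner ℂ (d k q) ψ := if_pos hk
  have hsupp : x.support ⊆ s := Finsupp.support_onFinset_subset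
  have h1 : inner ℂ (comb d x) ψ = (A : ℂ) := by
    rw [← pairFin_eq_inner (y := fun k q => inner ℂ (d k q) ψ) (fun _ _ => rfl), pairFin,
      Finsupp.sum_of_support_subset _ hsupp _ (by simp), hA, Complex.ofReal_sum]
    refine Finset.sum_congr rfl fun k hk => ?_
    rw [hxs k hk, EuclideanSpace.norm_sq_eq, dotProduct, Complex.ofReal_sum]
    refine Finset.sum_congr rfl fun q _ => ?_
    rw [Pi.star_apply, Complex.star_def, Complex.mul_conj, Complex.normSq_eq_norm_sq]
  have h2 : ‖toSeq x‖ ^ 2 = A := by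
    have h3 : ((‖toSeq x‖ ^ 2 : ℝ) : ℂ) = inner ℂ (toSeq x) (toSeq x) := by
      rw [inner_self_eq_norm_sq_to_K]; norm_cast
    have h4 : inner ℂ (toSeq x) (toSeq x) = (A : ℂ) := by
      rw [inner_toSeq_left, ← h1, ← pairFin_eq_inner (y := fun k q => inner ℂ (d k q) ψ)
        (fun _ _ => rfl), pairFin, pairFin, Finsupp.sum, Finsupp.sum]
      refine Finset.sum_congr rfl fun k hk => ?_
      rw [toSeq_apply, hxs k (hsupp hk)]
    rw [h4] at h3
    exact_mod_cast h3
  have h3 := norm_comb_sq_le hB hK x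
  have h4 : A ≤ ‖comb d x‖ * ‖ψ‖ := by
    have := norm_inner_le_norm (𝕜 := ℂ) (comb d x) ψ
    rwa [h1, Complex.norm_real, Real.norm_of_nonneg hA0] at this
  rw [h2] at h3
  rcases hA0.eq_or_lt with h0 | h0
  · rw [← h0]; positivity
  · have : A * A ≤ A * (‖B‖ * ‖ψ‖ ^ 2) := by
      calc A * A ≤ (‖comb d x‖ * ‖ψ‖) * (‖comb d x‖ * ‖ψ‖) := by gcongr
        _ = ‖comb d x‖ ^ 2 * ‖ψ‖ ^ 2 := by ring
        _ ≤ (‖B‖ * A) * ‖ψ‖ ^ 2 := by gcongr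
        _ = _ := by ring
    exact le_of_mul_le_mul_left this h0

/-- When a Gram matrix is a bounded operator in `ℓ₂` with a bounded inverse, the ordinary inverse
maps `⟨d, φ⟩` to the coordinates of `φ`. -/
theorem HasBlockMatrix.symm_apply [DecidableEq U] {B : SeqSpace T U ≃L[ℂ] SeqSpace T U}
    (hB : HasBlockMatrix B K) (hK : ∀ k j p q, K k j p q = inner ℂ (d k q) (d j p))
    (hed : ∀ k q j p, inner ℂ (e k q) (d j p) = if k = j ∧ q = p then 1 else 0)
    {φ : H} (hφ : φ ∈ (spanOn d Set.univ).topologicalClosure) {y c : U → Fin T → ℂ}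
    (hy : ∀ k q, y k q = inner ℂ (d k q) φ) (hc : ∀ k q, c k q = inner ℂ (e k q) φ) :
    ∃ z : SeqSpace T U, (∀ k, WithLp.ofLp (z k) = y k) ∧ (∀ k, WithLp.ofLp (B.symm z k) = c k) ∧
      HasSum (fun k => WithLp.ofLp (z k) ⬝ᵥ star (WithLp.ofLp (B.symm z k)))
        ((‖φ‖ ^ 2 : ℝ) : ℂ) := by
  have hB' : HasBlockMatrix (B : SeqSpace T U →L[ℂ] SeqSpace T U) K := hB
  set M := ‖(B : SeqSpace T U →L[ℂ] SeqSpace T U)‖ with hM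
  have hbes (ψ : H) (s : Finset U) :
      ∑ k ∈ s, ‖(WithLp.toLp 2 fun q => inner ℂ (d k q) ψ : EuclideanSpace ℂ (Fin T))‖
        ^ (2 : ℝ≥0∞).toReal ≤ M * ‖ψ‖ ^ 2 := by
    simpa using sum_norm_inner_sq_le hB' hK ψ s
  let D (ψ : H) : SeqSpace T U :=
    ⟨fun k => WithLp.toLp 2 fun q => inner ℂ (d k q) ψ, memℓp_gen' (hbes ψ)⟩
  have hD (ψ : H) : ‖D ψ‖ ≤ Real.sqrt (M * ‖ψ‖ ^ 2) := by
    refine lp.norm_le_of_forall_sum_le (by simp) (Real.sqrt_nonneg _) fun s => ?_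
    rw [ENNReal.toReal_ofNat, Real.rpow_two, Real.sq_sqrt (by positivity)]
    simpa using hbes ψ s
  have hDsub (ψ ψ' : H) : D ψ - D ψ' = D (ψ - ψ') := by
    ext k q
    exact (inner_sub_right _ _ _).symm
  obtain ⟨x, -, hx⟩ := exists_tendsto_comb d hφ
  have hBx (n : ℕ) : B (toSeq (x n)) = D (comb d (x n)) := by
    ext k q
    have := congrFun (hB.apply_toSeq (x n) k) q
    rw [applyFin_eq_inner hK] at this
    exact this
  have hlimD : Tendsto (fun n => D (comb d (x n))) atTop (𝓝 (D φ)) := by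
    rw [tendsto_iff_norm_sub_tendsto_zero] at hx ⊢
    have h1 : Tendsto (fun n => Real.sqrt (M * ‖comb d (x n) - φ‖ ^ 2)) atTop (𝓝 0) := by
      simpa using ((hx.pow 2).const_mul M).sqrt
    refine squeeze_zero (fun _ => norm_nonneg _) (fun n => ?_) h1
    rw [hDsub]
    exact hD _
  have hlim : Tendsto (fun n => toSeq (x n)) atTop (𝓝 (B.symm (D φ))) := by
    have := (B.symm.continuous.tendsto (D φ)).comp hlimD
    refine this.congr fun n => ?_
    rw [Function.comp_apply, ← hBx, B.symm_apply_apply]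
  refine ⟨D φ, fun k => ?_, fun k => ?_, ?_⟩
  · ext q; exact (hy k q).symm
  · ext q
    have hcoord : Continuous fun z : SeqSpace T U => WithLp.ofLp (z k) q := by
      have h1 : Continuous fun z : SeqSpace T U => z k := by
        have := (lp.uniformContinuous_coe (E := fun _ : U => EuclideanSpace ℂ (Fin T))
          (p := 2)).continuous
        exact (continuous_apply k).comp this
      exact (continuous_apply q).comp ((PiLp.continuous_ofLp 2 _).comp h1)
    refine tendsto_nhds_unique ((hcoord.tendsto _).comp hlim) ?_
    simp only [Function.comp_def, toSeq_apply, ← inner_comb_of_biorthogonal hed, hc]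
    exact tendsto_const_nhds.inner hx
  · have h1 : inner ℂ (B.symm (D φ)) (D φ) = ((‖φ‖ ^ 2 : ℝ) : ℂ) := by
      refine tendsto_nhds_unique (hlim.inner tendsto_const_nhds) ?_
      simp only [inner_toSeq_left]
      have h2 : ((‖φ‖ ^ 2 : ℝ) : ℂ) = inner ℂ φ φ := by
        rw [inner_self_eq_norm_sq_to_K]; norm_cast
      have h3 (n : ℕ) : pairFin (fun k => WithLp.ofLp (D φ k)) (x n) = inner ℂ (comb d (x n)) φ :=
        pairFin_eq_inner (fun _ _ => rfl) _
      simp only [h3, h2]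
      exact hx.inner tendsto_const_nhds
    rw [← h1]
    exact lp.hasSum_inner (B.symm (D φ)) (D φ)

end Bounded

/-! ### Factorization of the spectral densities -/

lemma re_mul_inv_mul_self_le {A B : Matrix (Fin T) (Fin T) ℂ} (hA : A.PosSemidef)
    (hB : B.PosSemidef) (hu : IsUnit (A + B)) (p : Fin T) :
    ((A * (A + B)⁻¹ * A) p p).re ≤ (A p p).re := by
  set W := A + B with hW
  have hdet : IsUnit W.det := (Matrix.isUnit_iff_isUnit_det W).1 hu
  have hWi : (W⁻¹)ᴴ = W⁻¹ := ((hA.add hB).inv).isHermitian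
  have hAh : Aᴴ = A := hA.isHermitian
  have h1 : W⁻¹ * W = 1 := Matrix.nonsing_inv_mul W hdet
  -- `A - A W⁻¹ A` is the sum of the congruence transforms of `A` by `1 - A W⁻¹` and of `B` by
  -- `A W⁻¹`
  have h2 := (hA.mul_mul_conjTranspose_same (1 - A * W⁻¹)).add
    (hB.mul_mul_conjTranspose_same (A * W⁻¹))
  have h3 : (1 - A * W⁻¹) * A * (1 - A * W⁻¹)ᴴ + A * W⁻¹ * B * (A * W⁻¹)ᴴ =
      A - A * W⁻¹ * A := by
    have hBA : B = W - A := by rw [hW]; abel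
    have h4 : A * W⁻¹ * W * (W⁻¹ * A) = A * W⁻¹ * A := by
      rw [Matrix.mul_assoc A, h1, Matrix.mul_one, Matrix.mul_assoc]
    rw [conjTranspose_sub, conjTranspose_mul, conjTranspose_one, hWi, hAh, hBA,
      Matrix.mul_sub (A * W⁻¹) W A, Matrix.sub_mul (A * W⁻¹ * W), h4]
    noncomm_ring
  rw [h3] at h2
  have h5 := (Complex.le_def.1 (h2.diag_nonneg (i := p))).1
  rw [Matrix.sub_apply, Complex.sub_re, Complex.zero_re] at h5
  linarith

/-- A Hermitian square root `S` of `W = F + G` and its inverse `D`, with square integrable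
entries. The rows of `F D` are square integrable since `F W⁻¹ F ≤ F`. -/
theorem exists_factorization {F G : ℝ → Matrix (Fin T) (Fin T) ℂ}
    (hF : MatIntegrable F) (hG : MatIntegrable G)
    (hF0 : ∀ᵐ t ∂circleProb, (F t).PosSemidef) (hG0 : ∀ᵐ t ∂circleProb, (G t).PosSemidef)
    (hmin : Minimality fun t => F t + G t) :
    ∃ S D : ℝ → Matrix (Fin T) (Fin T) ℂ,
      (∀ p q, AEStronglyMeasurable (fun t => S t p q) circleProb) ∧
      (∀ p q, AEStronglyMeasurable (fun t => D t p q) circleProb) ∧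
      (∀ p, SqIntegrable fun t => S t p) ∧ (∀ p, SqIntegrable fun t => D t p) ∧
      (∀ p, SqIntegrable fun t => (F t * D t) p) ∧
      ∀ᵐ t ∂circleProb, (S t)ᴴ = S t ∧ (D t)ᴴ = D t ∧ S t * D t = 1 ∧ D t * S t = 1 ∧
        S t * S t = F t + G t ∧ D t * D t = (F t + G t)⁻¹ := by
  have hFi (p q) : Integrable (fun t => F t p q) circleProb := integrable_circleProb.2 (hF p q)
  have hGi (p q) : Integrable (fun t => G t p q) circleProb := integrable_circleProb.2 (hG p q)
  have hWi (p q) : Integrable (fun t => (F t + G t) p q) circleProb := (hFi p q).add (hGi p q)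
  have hVi (p q) : Integrable (fun t => (F t + G t)⁻¹ p q) circleProb :=
    integrable_circleProb.2 (hmin.2 p q)
  have hunit : ∀ᵐ t ∂circleProb, IsUnit (F t + G t) := by
    rw [ae_circleProb]; exact hmin.1
  have hW0 : ∀ᵐ t ∂circleProb, (F t + G t).PosSemidef := by
    filter_upwards [hF0, hG0] with t h1 h2
    exact h1.add h2
  obtain ⟨S, hSm, hS⟩ := exists_measurable_sqrt (fun p q => (hWi p q).1) hW0
  have hmul {A B : ℝ → Matrix (Fin T) (Fin T) ℂ}
      (hA : ∀ p q, AEStronglyMeasurable (fun t => A t p q) circleProb)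
      (hB : ∀ p q, AEStronglyMeasurable (fun t => B t p q) circleProb) (p q) :
      AEStronglyMeasurable (fun t => (A t * B t) p q) circleProb := by
    simp only [Matrix.mul_apply]
    exact Finset.aestronglyMeasurable_fun_sum _ fun r _ => (hA p r).mul (hB r q)
  have hDm := hmul hSm fun p q => (hVi p q).1
  have hall : ∀ᵐ t ∂circleProb, (S t)ᴴ = S t ∧ (S t * (F t + G t)⁻¹)ᴴ = S t * (F t + G t)⁻¹ ∧
      S t * (S t * (F t + G t)⁻¹) = 1 ∧ S t * (F t + G t)⁻¹ * S t = 1 ∧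
        S t * S t = F t + G t ∧
          S t * (F t + G t)⁻¹ * (S t * (F t + G t)⁻¹) = (F t + G t)⁻¹ := by
    filter_upwards [hS, hunit] with t ⟨h1, h2⟩ h3
    have hdet := (Matrix.isUnit_iff_isUnit_det _).1 h3
    have h4 : S t * (S t * (F t + G t)⁻¹) = 1 := by
      rw [← Matrix.mul_assoc, h2, Matrix.mul_nonsing_inv _ hdet]
    have h5 : S t * (F t + G t)⁻¹ * S t = 1 := mul_eq_one_comm.1 h4
    have h6 : (S t)⁻¹ = S t * (F t + G t)⁻¹ := Matrix.inv_eq_right_inv h4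
    refine ⟨h1, ?_, h4, h5, h2, ?_⟩
    · rw [← h6, conjTranspose_nonsing_inv, h1]
    · rw [← Matrix.mul_assoc, h5, Matrix.one_mul]
  refine ⟨S, fun t => S t * (F t + G t)⁻¹, hSm, hDm, ?_, ?_, ?_, hall⟩
  · refine sqIntegrable_of_re_le hSm hWi ?_
    filter_upwards [hall] with t ⟨h1, _, _, _, h2, _⟩ p
    rw [h1, h2]
  · refine sqIntegrable_of_re_le hDm hVi ?_
    filter_upwards [hall] with t ⟨_, h1, _, _, _, h2⟩ p
    rw [h1, h2]
  · refine sqIntegrable_of_re_le (hmul (fun p q => (hFi p q).1) hDm) hFi ?_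
    filter_upwards [hall, hF0, hG0, hunit] with t ⟨_, h1, _, _, _, h2⟩ hF hG hu p
    rw [conjTranspose_mul, h1, hF.isHermitian, Matrix.mul_assoc, ← Matrix.mul_assoc _ _ (F t), h2,
      ← Matrix.mul_assoc]
    exact re_mul_inv_mul_self_le hF hG hu p

lemma exists_sqrt_rows {F : ℝ → Matrix (Fin T) (Fin T) ℂ} (hF : MatIntegrable F)
    (hF0 : ∀ᵐ t ∂circleProb, (F t).PosSemidef) :
    ∃ R : ℝ → Matrix (Fin T) (Fin T) ℂ, (∀ p, SqIntegrable fun t => R t p) ∧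
      ∀ᵐ t ∂circleProb, R t * (R t)ᴴ = F t := by
  have hFi (p q) : Integrable (fun t => F t p q) circleProb := integrable_circleProb.2 (hF p q)
  obtain ⟨R, hRm, hR⟩ := exists_measurable_sqrt (fun p q => (hFi p q).1) hF0
  have hRR : ∀ᵐ t ∂circleProb, R t * (R t)ᴴ = F t := by
    filter_upwards [hR] with t ⟨h1, h2⟩
    rw [h1, h2]
  exact ⟨R, sqIntegrable_of_re_le hRm hFi (hRR.mono fun t ht p => by rw [ht]), hRR⟩

/-! ### Covariances as inner products -/

section Probability

variable {Ω : Type*} [MeasurableSpace Ω] {P : Measure Ω}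

lemma covariance_eq_inner (X Y : Lp ℂ 2 P) : covariance P X Y = inner ℂ Y X := by
  rw [L2.inner_def]; rfl

lemma meanSquareError_eq (X Y : Lp ℂ 2 P) : meanSquareError P X Y = ‖X - Y‖ ^ 2 := by
  rw [norm_sq_eq_integral]
  refine integral_congr_ae ?_
  filter_upwards [Lp.coeFn_sub X Y] with ω h
  rw [h, Pi.sub_apply]

lemma IsStationaryWithDensity.inner_eq {ξ : ℤ → Fin T → Lp ℂ 2 P}
    {F : ℝ → Matrix (Fin T) (Fin T) ℂ} (h : IsStationaryWithDensity P ξ F) (m n : ℤ)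
    (p q : Fin T) : inner ℂ (ξ m q) (ξ n p) = fourierCoef (fun t => F t p q) (m - n) := by
  have := h.correlation m (n - m) p q
  rw [add_sub_cancel, covariance_eq_inner] at this
  rw [this, fourierCoef, neg_sub]

lemma Uncorrelated.inner_eq_zero {ξ η : ℤ → Fin T → Lp ℂ 2 P} (h : Uncorrelated P ξ η) (m n : ℤ)
    (p q : Fin T) : inner ℂ (η m q) (ξ n p) = 0 := by
  rw [← covariance_eq_inner]; exact h _ _ _ _

lemma Uncorrelated.inner_eq_zero' {ξ η : ℤ → Fin T → Lp ℂ 2 P} (h : Uncorrelated P ξ η) (m n : ℤ)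
    (p q : Fin T) : inner ℂ (ξ m q) (η n p) = 0 := by
  rw [← inner_conj_symm, h.inner_eq_zero, map_zero]

/-- The optimal estimate is characterized by the orthogonality of the error to the observations. -/
lemma isOptimalEstimate_of_inner_eq_zero {ζ : ℤ → Fin T → Lp ℂ 2 P} {O : Set ℤ} {X Y : Lp ℂ 2 P}
    (hY : Y ∈ observationSpace P ζ O) (h : ∀ n ∈ O, ∀ p, inner ℂ (ζ n p) (X - Y) = 0) :
    IsOptimalEstimate P ζ O X Y ∧ ∀ Y', IsOptimalEstimate P ζ O X Y' → Y' = Y := by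
  have key (Z) (hZ : Z ∈ observationSpace P ζ O) :
      ‖X - Z‖ ^ 2 = ‖X - Y‖ ^ 2 + ‖Y - Z‖ ^ 2 := by
    have h1 : inner ℂ (Y - Z) (X - Y) = 0 :=
      inner_eq_zero_of_mem_closure h (Submodule.sub_mem _ hY hZ)
    have h2 := norm_add_sq_eq_norm_sq_add_norm_sq_of_inner_eq_zero (Y - Z) (X - Y) h1
    rw [show Y - Z + (X - Y) = X - Z by abel] at h2
    nlinarith [h2]
  refine ⟨⟨hY, fun Z hZ => ?_⟩, fun Y' hY' => ?_⟩
  · rw [meanSquareError_eq, meanSquareError_eq, key Z hZ]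
    exact le_add_of_nonneg_right (by positivity)
  · have h1 := hY'.2 Y hY
    rw [meanSquareError_eq, meanSquareError_eq, key Y' hY'.1] at h1
    have h2 : ‖Y - Y'‖ ^ 2 = 0 := le_antisymm (by linarith) (by positivity)
    exact (sub_eq_zero.1 (norm_eq_zero.1 (pow_eq_zero_iff two_ne_zero |>.1 h2))).symm

end Probability

/-! ### Convergence of the series -/

lemma summable_sum_smul {H : Type*} [NormedAddCommGroup H] [NormedSpace ℂ H] [CompleteSpace H]
    {Z : Set ℤ} {a : ℤ → Fin T → ℂ} (ha : Summable fun j : Z => ∑ k, ‖a j k‖)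
    {v : ℤ → Fin T → H} (hv : ∀ n k, ‖v n k‖ = ‖v 0 k‖) :
    Summable fun j : Z => ∑ k, a j k • v (-(j : ℤ)) k := by
  refine Summable.of_norm_bounded (ha.mul_right (∑ k, ‖v 0 k‖)) fun j => ?_
  refine (norm_sum_le _ _).trans ?_
  rw [Finset.sum_mul]
  refine Finset.sum_le_sum fun k _ => ?_
  rw [norm_smul, hv]
  gcongr
  exact Finset.single_le_sum (f := fun k => ‖v 0 k‖) (fun _ _ => norm_nonneg _) (Finset.mem_univ k)

lemma hasSum_subtype_of_subset {V : Type*} [AddCommMonoid V] [TopologicalSpace V] {Z U : Set ℤ}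
    (hZU : Z ⊆ U) {g : ℤ → V} (hg : ∀ j ∉ Z, g j = 0) {s : V}
    (h : HasSum (fun j : Z => g j) s) : HasSum (fun j : U => g j) s := by
  have h1 : Set.indicator Z g = g := Set.indicator_eq_self.2 fun j hj => by
    by_contra h'
    exact hj (hg j h')
  have h2 : Set.indicator U g = g := Set.indicator_eq_self.2 fun j hj => by
    by_contra h'
    exact hj (hg j fun hz => h' (hZU hz))
  have h3 := (hasSum_subtype_iff_indicator (f := g)).1 h
  rw [h1, ← h2] at h3
  exact hasSum_subtype_iff_indicator.2 h3

/-! ### Spectral characteristics -/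

section Isometry

variable {ι H H' : Type*} [NormedAddCommGroup H] [InnerProductSpace ℂ H]
  [NormedAddCommGroup H'] [InnerProductSpace ℂ H'] {e : ι → Fin T → H} {ζ : ι → Fin T → H'}

/-- Systems of vectors with the same Gram matrix have isometric closed spans: this is the isometry
between the spectral domain and the span of the random variables. -/
lemma exists_tendsto_comb_of_gram_eq [CompleteSpace H']
    (h : ∀ m q n p, inner ℂ (e m q) (e n p) = inner ℂ (ζ m q) (ζ n p))
    {x : ℕ → (ι →₀ (Fin T → ℂ))} {θ : H} (hx : Tendsto (fun n => comb e (x n)) atTop (𝓝 θ)) :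
    ∃ Y, Tendsto (fun n => comb ζ (x n)) atTop (𝓝 Y) := by
  refine cauchySeq_tendsto_of_complete ?_
  have := hx.cauchySeq
  rw [Metric.cauchySeq_iff] at this ⊢
  simpa only [dist_eq_norm, ← map_sub, norm_comb_congr h] using this

lemma eq_of_tendsto_comb_of_gram_eq
    (h : ∀ m q n p, inner ℂ (e m q) (e n p) = inner ℂ (ζ m q) (ζ n p))
    {x x' : ℕ → (ι →₀ (Fin T → ℂ))} {θ θ' : H} {Y : H'}
    (hx : Tendsto (fun n => comb e (x n)) atTop (𝓝 θ))
    (hx' : Tendsto (fun n => comb e (x' n)) atTop (𝓝 θ'))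
    (hY : Tendsto (fun n => comb ζ (x n)) atTop (𝓝 Y))
    (hY' : Tendsto (fun n => comb ζ (x' n)) atTop (𝓝 Y)) : θ = θ' := by
  have h1 := (hx.sub hx').norm
  have h2 := (hY.sub hY').norm
  simp only [← map_sub, norm_comb_congr h] at h1
  simp only [← map_sub, sub_self, norm_zero] at h2
  exact sub_eq_zero.1 (norm_eq_zero.1 (tendsto_nhds_unique h1 h2))

end Isometry

lemma tendsto_weightedNormSq_iff {S V : ℝ → Matrix (Fin T) (Fin T) ℂ}
    (hS : ∀ p, SqIntegrable fun t => S t p) (hV : ∀ᵐ t ∂circleProb, S t * (S t)ᴴ = V t)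
    {h : ℝ → Fin T → ℂ} {θ : VecL2 T}
    (hθ : ∀ᵐ t ∂circleProb, WithLp.ofLp (θ t) = h t ᵥ* S t) (x : ℕ → (ℤ →₀ (Fin T → ℂ))) :
    Tendsto (fun n => weightedNormSq V (fun t => trigPoly (x n) t - h t)) atTop (𝓝 0) ↔
      Tendsto (fun n => comb (charRow S hS) (x n)) atTop (𝓝 θ) := by
  have h1 (n : ℕ) : weightedNormSq V (fun t => trigPoly (x n) t - h t) =
      ENNReal.ofReal (‖comb (charRow S hS) (x n) - θ‖ ^ 2) := by
    refine weightedNormSq_eq_norm_sq hV ?_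
    filter_upwards [hθ, coeFn_comb_charRow hS (x n), Lp.coeFn_sub (comb (charRow S hS) (x n)) θ]
      with t h2 h3 h4
    rw [h4, Pi.sub_apply, WithLp.ofLp_sub, h2, h3, Matrix.sub_vecMul]
  simp only [h1]
  rw [tendsto_iff_norm_sub_tendsto_zero (f := fun n => comb (charRow S hS) (x n))]
  constructor
  · intro h2
    have h3 := ((ENNReal.tendsto_toReal ENNReal.zero_ne_top).comp h2).sqrt
    simp only [Function.comp_def, ENNReal.toReal_ofReal (sq_nonneg _), ENNReal.toReal_zero,
      Real.sqrt_zero, Real.sqrt_sq (norm_nonneg _)] at h3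
    exact h3
  · intro h2
    have h3 := ENNReal.tendsto_ofReal (h2.pow 2)
    simpa using h3

/-- The spectral characteristic is unique, and it is the function `h` whose image `hᵀ S` is the
limit `θ` of the combinations of the rows of `exp (i n t) S` corresponding to the estimate `Y`. -/
theorem isSpectralCharacteristic_iff {Ω : Type*} [MeasurableSpace Ω] {P : Measure Ω}
    {ζ : ℤ → Fin T → Lp ℂ 2 P} {S D V : ℝ → Matrix (Fin T) (Fin T) ℂ}
    (hSm : ∀ p q, AEStronglyMeasurable (fun t => S t p q) circleProb)
    (hDm : ∀ p q, AEStronglyMeasurable (fun t => D t p q) circleProb)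
    (hS : ∀ p, SqIntegrable fun t => S t p) (hV : ∀ᵐ t ∂circleProb, S t * (S t)ᴴ = V t)
    (hSD : ∀ᵐ t ∂circleProb, S t * D t = 1)
    (hgram : ∀ m q n p, inner ℂ (charRow S hS m q) (charRow S hS n p) = inner ℂ (ζ m q) (ζ n p))
    {O : Set ℤ} {x : ℕ → (ℤ →₀ (Fin T → ℂ))} (hxO : ∀ n, ((x n).support : Set ℤ) ⊆ O)
    {θ : VecL2 T} (hx : Tendsto (fun n => comb (charRow S hS) (x n)) atTop (𝓝 θ))
    {Y : Lp ℂ 2 P} (hY : Tendsto (fun n => comb ζ (x n)) atTop (𝓝 Y)) (h : ℝ → Fin T → ℂ) :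
    IsSpectralCharacteristic P ζ V O h Y ↔
      ∀ᵐ t ∂circleProb, WithLp.ofLp (θ t) = h t ᵥ* S t := by
  constructor
  · rintro ⟨hh, x', hx'O, hx', hY'⟩
    have hsq := hh.sqIntegrable hSm hV
    have h1 := coeFn_vecL2 _ hsq
    have h2 := (tendsto_weightedNormSq_iff hS hV h1 x').1 hx'
    rw [eq_of_tendsto_comb_of_gram_eq hgram hx h2 hY hY']
    exact h1
  · intro hθ
    refine ⟨⟨fun p => ?_, ?_⟩, x, hxO, (tendsto_weightedNormSq_iff hS hV hθ x).2 hx, hY⟩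
    · rw [← aestronglyMeasurable_circleProb]
      have h1 : AEStronglyMeasurable (fun t => ∑ k, WithLp.ofLp (θ t) k * D t k p) circleProb :=
        Finset.aestronglyMeasurable_fun_sum _ fun k _ => ((sqIntegrable_coeFn θ k).1).mul (hDm k p)
      refine h1.congr ?_
      filter_upwards [hθ, hSD] with t h2 h3
      change (WithLp.ofLp (θ t) ᵥ* D t) p = h t p
      rw [h2, vecMul_vecMul, h3, vecMul_one]
    · rw [weightedNormSq_eq_norm_sq hV hθ]
      exact ENNReal.ofReal_lt_top

/-! ### The error of the estimate in the spectral domain -/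

lemma re_quadratic_sub_add {F : Matrix (Fin T) (Fin T) ℂ} (hF : Fᴴ = F)
    (G : Matrix (Fin T) (Fin T) ℂ) (A h : Fin T → ℂ) :
    ((A - h) ⬝ᵥ (F *ᵥ star (A - h))).re + (h ⬝ᵥ (G *ᵥ star h)).re =
      (A ⬝ᵥ (F *ᵥ star A)).re - 2 * (h ⬝ᵥ (F *ᵥ star A)).re + (h ⬝ᵥ ((F + G) *ᵥ star h)).re := by
  have h1 : A ⬝ᵥ (F *ᵥ star h) = star (h ⬝ᵥ (F *ᵥ star A)) := by
    rw [← star_dotProduct_star, star_mulVec, star_star, hF, ← dotProduct_mulVec]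
  rw [star_sub, mulVec_sub, dotProduct_sub, sub_dotProduct, sub_dotProduct, add_mulVec,
    dotProduct_add, h1]
  simp only [Complex.sub_re, Complex.add_re, Complex.star_def, Complex.conj_re]
  ring

/-- The two error integrals add up to `‖Aᵀ R‖² - 2 Re ⟨Aᵀ F, h⟩ + ‖hᵀ S‖²`, where `R` and `S` are
square roots of `F` and `F + G`. The cross term is expressed through any `γ` that represents the
functional `⟨Aᵀ F, h⟩` on `θ = hᵀ S`. -/
theorem weightedNormSq_add_eq {S R F G : ℝ → Matrix (Fin T) (Fin T) ℂ}
    (hG : ∀ p q, AEStronglyMeasurable (fun t => G t p q) circleProb)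
    (hF0 : ∀ᵐ t ∂circleProb, (F t).PosSemidef) (hG0 : ∀ᵐ t ∂circleProb, (G t).PosSemidef)
    (hR : ∀ᵐ t ∂circleProb, R t * (R t)ᴴ = F t) (hS : ∀ᵐ t ∂circleProb, S t * (S t)ᴴ = F t + G t)
    {A h : ℝ → Fin T → ℂ} (hh : ∀ p, AEStronglyMeasurable (fun t => h t p) circleProb)
    {ρ γ θ : VecL2 T} (hρ : ∀ᵐ t ∂circleProb, WithLp.ofLp (ρ t) = A t ᵥ* R t)
    (hθ : ∀ᵐ t ∂circleProb, WithLp.ofLp (θ t) = h t ᵥ* S t)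
    (hγ : ∀ᵐ t ∂circleProb, WithLp.ofLp (θ t) ⬝ᵥ star (WithLp.ofLp (γ t)) =
      h t ⬝ᵥ (F t *ᵥ star (A t))) :
    weightedNormSq F (fun t => A t - h t) + weightedNormSq G h =
      ENNReal.ofReal (‖ρ‖ ^ 2 - 2 * (inner ℂ γ θ).re + ‖θ‖ ^ 2) := by
  have hi : Integrable (fun t => WithLp.ofLp (θ t) ⬝ᵥ star (WithLp.ofLp (γ t))) circleProb :=
    (sqIntegrable_coeFn θ).integrable_dotProduct_star (sqIntegrable_coeFn γ)
  have hire : Integrable (fun t => 2 * (WithLp.ofLp (θ t) ⬝ᵥ star (WithLp.ofLp (γ t))).re)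
      circleProb := hi.re.const_mul 2
  have hρi := (Lp.memLp ρ).norm.integrable_sq
  have hθi := (Lp.memLp θ).norm.integrable_sq
  have hre : ∫ t, (WithLp.ofLp (θ t) ⬝ᵥ star (WithLp.ofLp (γ t))).re ∂circleProb =
      (inner ℂ γ θ).re := by
    rw [inner_eq_integral]
    exact integral_re hi
  have hint : ∫ t, (‖ρ t‖ ^ 2 - 2 * (WithLp.ofLp (θ t) ⬝ᵥ star (WithLp.ofLp (γ t))).re +
      ‖θ t‖ ^ 2) ∂circleProb = ‖ρ‖ ^ 2 - 2 * (inner ℂ γ θ).re + ‖θ‖ ^ 2 := by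
    rw [integral_add (f := fun t => ‖ρ t‖ ^ 2 -
      2 * (WithLp.ofLp (θ t) ⬝ᵥ star (WithLp.ofLp (γ t))).re) (hρi.sub hire) hθi,
      integral_sub hρi hire, integral_const_mul, hre, ← norm_sq_eq_integral, ← norm_sq_eq_integral]
  have hpt : ∀ᵐ t ∂circleProb,
      0 ≤ ((A t - h t) ⬝ᵥ (F t *ᵥ star (A t - h t))).re ∧ 0 ≤ (h t ⬝ᵥ (G t *ᵥ star (h t))).re ∧
      ((A t - h t) ⬝ᵥ (F t *ᵥ star (A t - h t))).re + (h t ⬝ᵥ (G t *ᵥ star (h t))).re =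
        ‖ρ t‖ ^ 2 - 2 * (WithLp.ofLp (θ t) ⬝ᵥ star (WithLp.ofLp (γ t))).re + ‖θ t‖ ^ 2 := by
    have hnn {V : Matrix (Fin T) (Fin T) ℂ} (hV : V.PosSemidef) (f : Fin T → ℂ) :
        0 ≤ (f ⬝ᵥ (V *ᵥ star f)).re := by
      have := hV.dotProduct_mulVec_nonneg (star f)
      rw [star_star] at this
      exact (Complex.le_def.1 this).1
    filter_upwards [hF0, hG0, hR, hS, hρ, hθ, hγ] with t h1 h2 h3 h4 h5 h6 h7
    refine ⟨hnn h1 _, hnn h2 _, ?_⟩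
    rw [re_quadratic_sub_add h1.isHermitian, h7, re_quadratic_eq h3, re_quadratic_eq h4,
      EuclideanSpace.norm_sq_eq, EuclideanSpace.norm_sq_eq, h5, h6]
  have hsum : Integrable (fun t => ‖ρ t‖ ^ 2 -
      2 * (WithLp.ofLp (θ t) ⬝ᵥ star (WithLp.ofLp (γ t))).re + ‖θ t‖ ^ 2) circleProb :=
    (hρi.sub hire).add hθi
  rw [← hint, ofReal_integral_eq_lintegral_ofReal hsum,
    weightedNormSq_eq_lintegral, weightedNormSq_eq_lintegral, ← lintegral_add_right']
  · refine lintegral_congr_ae ?_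
    filter_upwards [hpt] with t ⟨h1, h2, h3⟩
    rw [← ENNReal.ofReal_add h1 h2, h3]
  · refine ENNReal.measurable_ofReal.comp_aemeasurable
      (Complex.measurable_re.comp_aemeasurable ?_)
    refine AEStronglyMeasurable.aemeasurable ?_
    simp only [dotProduct, mulVec, Pi.star_apply]
    exact Finset.aestronglyMeasurable_fun_sum _ fun p _ => (hh p).mul
      (Finset.aestronglyMeasurable_fun_sum _ fun q _ => (hG p q).mul (hh q).star)
  · filter_upwards [hpt] with t ⟨h1, h2, h3⟩
    have := add_nonneg h1 h2
    rw [h3] at this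
    exact this

/-! ### Index sets -/

section Index

variable {s : ℕ} (M N : Fin s → ℕ)

lemma finite_missing : (missing M N).Finite := by
  refine (Set.finite_iUnion fun l => Set.finite_Icc (-((M l : ℤ) + N l)) (-(M l : ℤ))).subset ?_
  rintro j ⟨l, h1, h2⟩
  exact Set.mem_iUnion.2 ⟨l, h1, h2⟩

lemma finite_unobserved_neg : (unobserved M N ∩ {n | n < 0}).Finite := by
  refine (finite_missing M N).subset ?_
  rintro j ⟨h | h, h'⟩
  · exact h
  · simp only [Set.mem_ofPred_eq] at h h'
    omega

lemma notMem_unobserved_iff {n : ℤ} : n ∉ unobserved M N ↔ n ∈ observed M N := by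
  simp only [unobserved, observed, Set.mem_union, Set.mem_sdiff, Set.mem_ofPred_eq, not_or, not_le]
  exact and_comm

lemma target_subset_unobserved : target M N ⊆ unobserved M N :=
  fun j h => by
    have h1 : 1 ≤ j := h.1
    exact Or.inr (show 0 ≤ j by omega)

end Index

/-! ### The optimal estimate -/

/-- A vector orthogonal to the rows of `exp (i n t) S` for the observed instants `n` is a limit of
linear combinations of the rows of `exp (i n t) S⁻¹` for the unobserved instants. -/
theorem mem_closure_of_inner_charRow_eq_zero {S D : ℝ → Matrix (Fin T) (Fin T) ℂ}
    (hS : ∀ p, SqIntegrable fun t => S t p) (hD : ∀ p, SqIntegrable fun t => D t p)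
    (hSD : ∀ᵐ t ∂circleProb, (S t)ᴴ * D t = 1) {U : Set ℤ}
    (hU : ∀ n : ℤ, 0 ≤ n → n ∈ U) (hfin : (U ∩ {n | n < 0}).Finite)
    (hed : ∀ k q j p, inner ℂ (charRow S hS k q) (charRow D hD j p) =
      if k = j ∧ q = p then 1 else 0)
    {φ : VecL2 T} (hφ : ∀ n ∉ U, ∀ p, inner ℂ (charRow S hS n p) φ = 0) :
    φ ∈ (spanOn (fun k : U => charRow D hD k) Set.univ).topologicalClosure := by
  set N := (spanOn (fun k : U => charRow D hD k) Set.univ).topologicalClosure with hN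
  have : CompleteSpace N := (Submodule.isClosed_topologicalClosure _).completeSpace_coe
  have h0 : φ - N.starProjection φ = 0 := by
    refine eq_zero_of_inner_charRow_eq_zero hS hD hSD hU hfin (fun n hn p => ?_) (fun n hn p => ?_)
    · have h1 : inner ℂ (N.starProjection φ) (charRow S hS n p) = 0 := by
        refine inner_eq_zero_of_mem_closure (e := fun k : U => charRow D hD k) (O := Set.univ)
          (fun k _ q => ?_) (N.starProjection_apply_mem φ)
        rw [← inner_conj_symm, hed, if_neg, map_zero]
        rintro ⟨rfl, -⟩
        exact hn k.2
      rw [inner_sub_right, hφ n hn p, ← inner_conj_symm, h1, map_zero, sub_zero]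
    · exact N.sub_starProjection_mem_orthogonal φ _
        (Submodule.le_topologicalClosure _ (Submodule.subset_span ⟨⟨n, hn⟩, trivial, p, rfl⟩))
  rw [sub_eq_zero.1 h0]
  exact N.starProjection_apply_mem φ

/-- Two convergent series of vectors with the same Gram matrix have sums of the same norm. -/
lemma norm_eq_of_hasSum_of_gram_eq {ι H H' : Type*} [NormedAddCommGroup H] [InnerProductSpace ℂ H]
    [NormedAddCommGroup H'] [InnerProductSpace ℂ H'] {v : ι → H} {w : ι → H'}
    (h : ∀ i j, inner ℂ (v i) (v j) = inner ℂ (w i) (w j)) {s : H} {s' : H'} (hv : HasSum v s)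
    (hw : HasSum w s') : ‖s‖ = ‖s'‖ := by
  have h1 (i) : inner ℂ (v i) s = inner ℂ (w i) s' :=
    (hv.mapL (innerSL ℂ (v i))).unique <| (hw.mapL (innerSL ℂ (w i))).congr_fun fun j => h i j
  have h2 : inner ℂ s s = inner ℂ s' s' := by
    refine (hv.mapL (innerSL ℂ s)).unique <| (hw.mapL (innerSL ℂ s')).congr_fun fun i => ?_
    simp only [innerSL_apply_apply]
    rw [← inner_conj_symm, h1, inner_conj_symm]
  rw [inner_self_eq_norm_sq_to_K, inner_self_eq_norm_sq_to_K] at h2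
  exact (sq_eq_sq₀ (norm_nonneg _) (norm_nonneg _)).1 (by exact_mod_cast h2)

end Filtering

open Filtering in
theorem theorem1 {Ω : Type*} [MeasurableSpace Ω] (P : Measure Ω) [IsProbabilityMeasure P]
    {T s : ℕ} (M N : Fin s → ℕ) (hM : ∀ l, 1 ≤ M l)
    (ξ η : ℤ → Fin T → Lp ℂ 2 P) (F G : ℝ → Matrix (Fin T) (Fin T) ℂ)
    (hξ : Filtering.IsStationaryWithDensity P ξ F)
    (hη : Filtering.IsStationaryWithDensity P η G)
    (hξη : Filtering.Uncorrelated P ξ η)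
    (hmin : Filtering.Minimality (fun t => F t + G t))
    (a : ℤ → Fin T → ℂ)
    (ha : Summable fun j : Filtering.target M N => ∑ k, ‖a j k‖)
    (ha_zero : ∀ j, j ∉ Filtering.target M N → a j = 0) :
    -- the series and the Fourier integrals that occur below converge
    (Summable fun j : Filtering.target M N => ∑ k, a j k • ξ (-(j : ℤ)) k) ∧
    Filtering.MatIntegrable (fun t => F t * (F t + G t)⁻¹) ∧
    Filtering.MatIntegrable (fun t => F t * (F t + G t)⁻¹ * G t) ∧
    (∀ k : Filtering.unobserved M N, Summable fun j : Filtering.unobserved M N =>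
      a j ᵥ* Filtering.blockR F G k j) ∧
    (∀ k : Filtering.unobserved M N, Summable fun j : Filtering.unobserved M N =>
      a j ᵥ* Filtering.blockQ F G j k) ∧
    (Summable fun k : Filtering.unobserved M N =>
      Filtering.applyQ F G (Filtering.unobserved M N) a k ⬝ᵥ star (a k)) ∧
    ∃ (c : Filtering.unobserved M N → Fin T → ℂ) (q : ℂ) (C : ℝ → Fin T → ℂ) (Y : Lp ℂ 2 P),
      -- `c = B⁻¹ R a` and `q = ⟨R a, B⁻¹ R a⟩` exist and are unique
      Filtering.IsInverseImage (fun k j : Filtering.unobserved M N => Filtering.blockB F G k j)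
        (Filtering.applyR F G (Filtering.unobserved M N) a) c q ∧
      (∀ c' q', Filtering.IsInverseImage
        (fun k j : Filtering.unobserved M N => Filtering.blockB F G k j)
        (Filtering.applyR F G (Filtering.unobserved M N) a) c' q' → c' = c ∧ q' = q) ∧
      -- they have their usual meaning when `B` is an invertible bounded operator in `ℓ₂`
      (∀ B' : Filtering.SeqSpace T (Filtering.unobserved M N) ≃L[ℂ]
          Filtering.SeqSpace T (Filtering.unobserved M N),
        Filtering.HasBlockMatrix B'
          (fun k j : Filtering.unobserved M N => Filtering.blockB F G k j) →
        ∃ y : Filtering.SeqSpace T (Filtering.unobserved M N),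
          (∀ k, WithLp.ofLp (y k) = Filtering.applyR F G (Filtering.unobserved M N) a k) ∧
          (∀ k, WithLp.ofLp (B'.symm y k) = c k) ∧
          HasSum (fun k => WithLp.ofLp (y k) ⬝ᵥ star (WithLp.ofLp (B'.symm y k))) q) ∧
      -- `C = ∑_{k ∈ U} c(k) exp (i k t)`
      Filtering.HasFourierSeriesOn (Filtering.unobserved M N) c C ∧
      -- `Y` is the unique optimal linear estimate of `A ξ`
      Filtering.IsOptimalEstimate P (fun j k => ξ j k + η j k) (Filtering.observed M N)
        (Filtering.linFunctional P ξ (Filtering.target M N) a) Y ∧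
      (∀ Y', Filtering.IsOptimalEstimate P (fun j k => ξ j k + η j k) (Filtering.observed M N)
        (Filtering.linFunctional P ξ (Filtering.target M N) a) Y' → Y' = Y) ∧
      -- its spectral characteristic is `hᵀ = Aᵀ F (F+G)⁻¹ - Cᵀ (F+G)⁻¹`
      (∀ h : ℝ → Fin T → ℂ,
        Filtering.IsSpectralCharacteristic P (fun j k => ξ j k + η j k)
          (fun t => F t + G t) (Filtering.observed M N) h Y ↔
        h =ᵐ[Filtering.circleMeasure] fun t =>
          Filtering.functionalSymbol (Filtering.target M N) a t ᵥ* (F t * (F t + G t)⁻¹)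
            - C t ᵥ* (F t + G t)⁻¹) ∧
      -- the error is `(1/2π) ∫ r_Gᵀ F conj r_G + (1/2π) ∫ r_Fᵀ G conj r_F`, where
      -- `r_Gᵀ = (Aᵀ G + Cᵀ) (F+G)⁻¹` and `r_Fᵀ = (Aᵀ F - Cᵀ) (F+G)⁻¹`
      ENNReal.ofReal (Filtering.meanSquareError P
          (Filtering.linFunctional P ξ (Filtering.target M N) a) Y) =
        Filtering.weightedNormSq F (fun t =>
          (Filtering.functionalSymbol (Filtering.target M N) a t ᵥ* G t + C t)
            ᵥ* (F t + G t)⁻¹) +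
        Filtering.weightedNormSq G (fun t =>
          (Filtering.functionalSymbol (Filtering.target M N) a t ᵥ* F t - C t)
            ᵥ* (F t + G t)⁻¹) ∧
      -- and it equals `⟨R a, B⁻¹ R a⟩ + ⟨Q a, a⟩`
      ((Filtering.meanSquareError P
          (Filtering.linFunctional P ξ (Filtering.target M N) a) Y : ℝ) : ℂ) =
        q + ∑' k : Filtering.unobserved M N,
          Filtering.applyQ F G (Filtering.unobserved M N) a k ⬝ᵥ star (a k) := by
  classical
  have hF0 : ∀ᵐ t ∂circleProb, (F t).PosSemidef := by rw [ae_circleProb]; exact hξ.posSemidef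
  have hG0 : ∀ᵐ t ∂circleProb, (G t).PosSemidef := by rw [ae_circleProb]; exact hη.posSemidef
  have hFi (p q) : Integrable (fun t => F t p q) circleProb :=
    integrable_circleProb.2 (hξ.integrable p q)
  have hGi (p q) : Integrable (fun t => G t p q) circleProb :=
    integrable_circleProb.2 (hη.integrable p q)
  obtain ⟨S, D, hSm, hDm, hS, hD, hFD, hall⟩ :=
    exists_factorization hξ.integrable hη.integrable hF0 hG0 hmin
  obtain ⟨R, hR, hRR⟩ := exists_sqrt_rows hξ.integrable hF0
  set U := unobserved M N
  set Z := target M N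
  set O := observed M N
  have hZU : Z ⊆ U := target_subset_unobserved M N
  set ζ : ℤ → Fin T → Lp ℂ 2 P := fun j k => ξ j k + η j k with hζ
  -- algebraic identities between the factors
  have hSS : ∀ᵐ t ∂circleProb, S t * (S t)ᴴ = F t + G t := by
    filter_upwards [hall] with t ⟨h1, _, _, _, h2, _⟩
    rw [h1, h2]
  have hSD : ∀ᵐ t ∂circleProb, S t * D t = 1 := hall.mono fun t h => h.2.2.1
  have hSD' : ∀ᵐ t ∂circleProb, (S t)ᴴ * D t = 1 := by
    filter_upwards [hall] with t ⟨h1, _, h2, _⟩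
    rw [h1, h2]
  have hFW : ∀ᵐ t ∂circleProb, F t * D t * (D t)ᴴ = F t * (F t + G t)⁻¹ := by
    filter_upwards [hall] with t ⟨_, h1, _, _, _, h2⟩
    rw [h1, Matrix.mul_assoc, h2]
  have hFWG : ∀ᵐ t ∂circleProb,
      F t * (F t + G t)⁻¹ * G t = F t - F t * D t * (F t * D t)ᴴ := by
    filter_upwards [hall, hF0] with t ⟨_, h1, h3, h3', h4, h2⟩ hF
    have h5 : (F t + G t)⁻¹ * (F t + G t) = 1 := by
      rw [← h2, ← h4, Matrix.mul_assoc, ← Matrix.mul_assoc (D t) (S t), h3', Matrix.one_mul, h3']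
    have h6 : F t * (F t + G t)⁻¹ * G t + F t * (F t + G t)⁻¹ * F t = F t := by
      rw [← Matrix.mul_add, add_comm (G t), Matrix.mul_assoc, h5, Matrix.mul_one]
    rw [conjTranspose_mul, h1, hF.isHermitian, Matrix.mul_assoc (F t) (D t),
      ← Matrix.mul_assoc (D t) (D t), h2, ← Matrix.mul_assoc]
    exact eq_sub_of_add_eq h6
  -- Gram matrices: the rows of `S` reproduce the covariances of the observations, the rows of `D`
  -- represent `B` and are biorthogonal to those of `S`, and the rows of `F D` represent the
  -- projections of `ξ` on the span of all the sums `ξ + η`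
  have hee (m : ℤ) (q : Fin T) (n : ℤ) (p : Fin T) :
      inner ℂ (charRow S hS m q) (charRow S hS n p) = inner ℂ (ζ m q) (ζ n p) := by
    rw [inner_charRow_charRow, hζ, inner_add_left, inner_add_right, inner_add_right, hξ.inner_eq,
      hη.inner_eq, hξη.inner_eq_zero, hξη.inner_eq_zero', zero_add, add_zero,
      ← fourierCoef_add (hFi p q) (hGi p q)]
    exact fourierCoef_congr (hSS.mono fun t ht => by simp [ht]) _
  have hdd (k j : ℤ) (p q : Fin T) :
      blockB F G k j p q = inner ℂ (charRow D hD k q) (charRow D hD j p) := by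
    rw [inner_charRow_charRow]
    refine fourierCoef_congr ?_ _
    filter_upwards [hall] with t ⟨_, h1, _, _, _, h2⟩
    rw [h1, h2]
  have hed (k : ℤ) (q : Fin T) (j : ℤ) (p : Fin T) :
      inner ℂ (charRow S hS k q) (charRow D hD j p) = if k = j ∧ q = p then 1 else 0 := by
    have h1 : (fun t => (D t * (S t)ᴴ) p q) =ᵐ[circleProb] fun t => (if q = p then 1 else 0) *
        char 0 t := by
      filter_upwards [hall] with t ⟨h1, _, _, h2, _⟩
      rw [h1, h2, char_zero, mul_one, Matrix.one_apply]
      simp only [eq_comm]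
    rw [inner_charRow_charRow, fourierCoef_congr h1, fourierCoef_const_mul, fourierCoef_char]
    simp only [sub_eq_zero, ite_and, mul_ite, mul_one, mul_zero]
  have hdγ (k j : ℤ) (p q : Fin T) :
      blockR F G k j p q =
        inner ℂ (charRow D hD k q) (charRow (fun t => F t * D t) hFD (-j) p) := by
    rw [inner_charRow_charRow, sub_neg_eq_add]
    exact fourierCoef_congr (hFW.mono fun t ht => by simp [ht]) _
  have heγ (m n : ℤ) (p q : Fin T) :
      inner ℂ (charRow S hS m q) (charRow (fun t => F t * D t) hFD n p) =
        inner ℂ (ζ m q) (ξ n p) := by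
    rw [inner_charRow_charRow, hζ, inner_add_left, hξ.inner_eq, hξη.inner_eq_zero, add_zero]
    refine fourierCoef_congr ?_ _
    filter_upwards [hall] with t ⟨h1, _, _, h2, _⟩
    rw [h1, Matrix.mul_assoc, h2, Matrix.mul_one]
  have hγγi (p q) : Integrable (fun t => (F t * D t * (F t * D t)ᴴ) p q) circleProb :=
    integrable_mul_conjTranspose hFD hFD p q
  have hQγ (j k : ℤ) (p q : Fin T) : blockQ F G j k p q = inner ℂ (ξ (-k) q) (ξ (-j) p) -
      inner ℂ (charRow (fun t => F t * D t) hFD (-k) q)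
        (charRow (fun t => F t * D t) hFD (-j) p) := by
    rw [inner_charRow_charRow, hξ.inner_eq, neg_sub_neg, ← fourierCoef_sub (hFi p q) (hγγi p q)]
    exact fourierCoef_congr (hFWG.mono fun t ht => by simp [ht]) _
  have hrr (m : ℤ) (q : Fin T) (n : ℤ) (p : Fin T) :
      inner ℂ (charRow R hR m q) (charRow R hR n p) = inner ℂ (ξ m q) (ξ n p) := by
    rw [inner_charRow_charRow, hξ.inner_eq]
    exact fourierCoef_congr (hRR.mono fun t ht => by simp [ht]) _
  -- the series for `A ξ` and for its images in the spectral domain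
  have hξn (n : ℤ) (k : Fin T) : ‖ξ n k‖ = ‖ξ 0 k‖ := by
    rw [← sq_eq_sq₀ (norm_nonneg _) (norm_nonneg _), ← inner_self_eq_norm_sq (𝕜 := ℂ) (ξ n k),
      ← inner_self_eq_norm_sq (𝕜 := ℂ) (ξ 0 k), hξ.inner_eq, hξ.inner_eq, sub_self, sub_self]
  have hXs := summable_sum_smul ha hξn
  set X := linFunctional P ξ Z a
  have hXsum : HasSum (fun j : Z => ∑ k, a j k • ξ (-(j : ℤ)) k) X := hXs.hasSum
  obtain ⟨hΓi, hΓsum⟩ := hasSum_charRow_functionalSymbol hFD ha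
  obtain ⟨hρi, hρsum⟩ := hasSum_charRow_functionalSymbol hR ha
  have hΓc := coeFn_vecL2 _ hΓi
  have hρc := coeFn_vecL2 _ hρi
  set Γ := vecL2 _ hΓi
  set ρ := vecL2 _ hρi
  have hXU := hasSum_subtype_of_subset hZU (g := fun j => ∑ k, a j k • ξ (-j) k)
    (fun j hj => by simp [ha_zero j hj]) hXsum
  have hΓU := hasSum_subtype_of_subset hZU
    (g := fun j => ∑ k, a j k • charRow (fun t => F t * D t) hFD (-j) k)
    (fun j hj => by simp [ha_zero j hj]) hΓsum
  -- `Aᵀ R` is the image of `A ξ` under the isometry for the density `F`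
  have hnormX : ‖X‖ = ‖ρ‖ := by
    refine norm_eq_of_hasSum_of_gram_eq (fun i j => ?_) hXsum hρsum
    simp only [sum_inner, inner_sum, inner_smul_left, inner_smul_right, hrr]
  -- the action of the block matrices
  have hR1 (k : U) (q : Fin T) : HasSum (fun j : U => (a j ᵥ* blockR F G k j) q)
      (inner ℂ (charRow D hD k q) Γ) := by
    have := hΓU.mapL (innerSL ℂ (charRow D hD (k : ℤ) q))
    refine this.congr_fun fun j => ?_
    simp only [innerSL_apply_apply, inner_sum, inner_smul_right, vecMul, dotProduct, hdγ]
  have hRsum (k : U) : HasSum (fun j : U => a j ᵥ* blockR F G k j)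
      (fun q => inner ℂ (charRow D hD (k : ℤ) q) Γ) := Pi.hasSum.2 fun q => hR1 k q
  have hQ1 (k : U) (q : Fin T) : HasSum (fun j : U => (a j ᵥ* blockQ F G j k) q)
      (inner ℂ (ξ (-(k : ℤ)) q) X - inner ℂ (charRow (fun t => F t * D t) hFD (-(k : ℤ)) q) Γ) := by
    have h1 := hXU.mapL (innerSL ℂ (ξ (-(k : ℤ)) q))
    have h2 := hΓU.mapL (innerSL ℂ (charRow (fun t => F t * D t) hFD (-(k : ℤ)) q))
    refine (h1.sub h2).congr_fun fun j => ?_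
    simp only [innerSL_apply_apply, inner_sum, inner_smul_right, vecMul, dotProduct, hQγ, mul_sub,
      Finset.sum_sub_distrib]
  have hQsum (k : U) : HasSum (fun j : U => a j ᵥ* blockQ F G j k)
      (fun q => inner ℂ (ξ (-(k : ℤ)) q) X -
        inner ℂ (charRow (fun t => F t * D t) hFD (-(k : ℤ)) q) Γ) := Pi.hasSum.2 fun q => hQ1 k q
  have hRapp (k : U) (q : Fin T) : applyR F G U a k q = inner ℂ (charRow D hD (k : ℤ) q) Γ :=
    congrFun (hRsum k).tsum_eq q
  have hQapp (k : U) (q : Fin T) : applyQ F G U a k q = inner ℂ (ξ (-(k : ℤ)) q) X -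
      inner ℂ (charRow (fun t => F t * D t) hFD (-(k : ℤ)) q) Γ := congrFun (hQsum k).tsum_eq q
  have hQQ : HasSum (fun k : U => applyQ F G U a k ⬝ᵥ star (a k))
      (((‖X‖ ^ 2 - ‖Γ‖ ^ 2 : ℝ)) : ℂ) := by
    have h1 := ((hXU.mapL (innerSL ℂ X)).sub (hΓU.mapL (innerSL ℂ Γ))).star
    have h2 : star ((innerSL ℂ X) X - (innerSL ℂ Γ) Γ) = ((‖X‖ ^ 2 - ‖Γ‖ ^ 2 : ℝ) : ℂ) := by
      simp only [innerSL_apply_apply, inner_self_eq_norm_sq_to_K]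
      simp
    rw [h2] at h1
    refine h1.congr_fun fun k => ?_
    simp only [innerSL_apply_apply, inner_sum, inner_smul_right, dotProduct, hQapp, star_sub,
      star_sum, star_mul', Pi.star_apply, sub_mul, Finset.sum_sub_distrib]
    simp only [Complex.star_def, inner_conj_symm, mul_comm]
  -- the decomposition `Γ = θ + φ` into the part generated by the observed instants and its
  -- complement, which lies in the closed span of the rows of `D` for the unobserved instants
  set V := (spanOn (charRow S hS) O).topologicalClosure
  have : CompleteSpace V := (Submodule.isClosed_topologicalClosure _).completeSpace_coe
  set θ := V.starProjection Γ with hθdef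
  have hθV : θ ∈ V := V.starProjection_apply_mem Γ
  set φ := Γ - θ with hφdef
  have hφV : ∀ v ∈ V, inner ℂ v φ = 0 := fun v hv => V.sub_starProjection_mem_orthogonal Γ v hv
  have hφe (n : ℤ) (hn : n ∉ U) (p : Fin T) : inner ℂ (charRow S hS n p) φ = 0 :=
    hφV _ (Submodule.le_topologicalClosure _
      (Submodule.subset_span ⟨n, (notMem_unobserved_iff M N).1 hn, p, rfl⟩))
  have hφcl := mem_closure_of_inner_charRow_eq_zero hS hD hSD' (U := U) (fun n hn => Or.inr hn)
    (finite_unobserved_neg M N) hed hφe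
  have hdθ (k : U) (q : Fin T) : inner ℂ (charRow D hD (k : ℤ) q) θ = 0 := by
    rw [← inner_conj_symm, inner_eq_zero_of_mem_closure (fun n hn p => ?_) hθV, map_zero]
    rw [hed, if_neg]
    rintro ⟨rfl, -⟩
    exact (notMem_unobserved_iff M N).2 hn k.2
  have hy (k : U) (q : Fin T) : applyR F G U a k q = inner ℂ (charRow D hD (k : ℤ) q) φ := by
    rw [hRapp, hφdef, inner_sub_right, hdθ, sub_zero]
  have hKB (k j : U) (p q : Fin T) : blockB F G k j p q =
      inner ℂ (charRow D hD (k : ℤ) q) (charRow D hD (j : ℤ) p) := hdd k j p q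
  have hedU (k : U) (q : Fin T) (j : U) (p : Fin T) :
      inner ℂ (charRow S hS (k : ℤ) q) (charRow D hD (j : ℤ) p) =
        if k = j ∧ q = p then 1 else 0 := by
    rw [hed]; simp only [Subtype.ext_iff]
  set c : U → Fin T → ℂ := fun k p => inner ℂ (charRow S hS (k : ℤ) p) φ with hc
  set C : ℝ → Fin T → ℂ := fun t => WithLp.ofLp (φ t) ᵥ* (S t)ᴴ with hC
  have hCi (p : Fin T) : Integrable (fun t => C t p) circleProb :=
    (sqIntegrable_coeFn φ).integrable_dotProduct_star (hS p)
  -- the estimate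
  obtain ⟨x, hxO, hxθ⟩ := exists_tendsto_comb (charRow S hS) hθV
  obtain ⟨Y, hxY⟩ := exists_tendsto_comb_of_gram_eq hee hxθ
  have hYmem : Y ∈ observationSpace P ζ O := by
    refine (Submodule.isClosed_topologicalClosure _).mem_of_tendsto hxY (.of_forall fun n => ?_)
    exact Submodule.le_topologicalClosure _ (comb_mem_spanOn ζ (hxO n))
  have heΓ (m : ℤ) (q : Fin T) : inner ℂ (charRow S hS m q) Γ = inner ℂ (ζ m q) X := by
    refine (hΓsum.mapL (innerSL ℂ (charRow S hS m q))).unique ?_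
    refine (hXsum.mapL (innerSL ℂ (ζ m q))).congr_fun fun j => ?_
    simp only [innerSL_apply_apply, inner_sum, inner_smul_right, heγ]
  have heθ (m : ℤ) (q : Fin T) : inner ℂ (charRow S hS m q) θ = inner ℂ (ζ m q) Y := by
    refine tendsto_nhds_unique (tendsto_const_nhds.inner hxθ)
      ((tendsto_const_nhds.inner hxY).congr fun n => ?_)
    exact (inner_comb_congr (hee m q) (x n)).symm
  have horth (n : ℤ) (hn : n ∈ O) (p : Fin T) : inner ℂ (ζ n p) (X - Y) = 0 := by
    rw [inner_sub_right, ← heΓ, ← heθ, ← inner_sub_right]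
    exact hφe n ((notMem_unobserved_iff M N).2 hn) p
  obtain ⟨hopt, huniq⟩ := isOptimalEstimate_of_inner_eq_zero hYmem horth
  have hYθ : ‖Y‖ = ‖θ‖ :=
    tendsto_nhds_unique hxY.norm (hxθ.norm.congr fun n => norm_comb_congr hee (x n))
  -- the spectral characteristic
  set h : ℝ → Fin T → ℂ := fun t => functionalSymbol Z a t ᵥ* (F t * (F t + G t)⁻¹) -
    C t ᵥ* (F t + G t)⁻¹ with hh
  have hθh : ∀ᵐ t ∂circleProb, WithLp.ofLp (θ t) = h t ᵥ* S t := by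
    have h1 : θ = Γ - φ := by rw [hφdef, sub_sub_cancel]
    have h2 := Lp.coeFn_sub Γ φ
    rw [← h1] at h2
    filter_upwards [h2, hΓc, hall] with t h2 h3 ⟨g1, _, g4, g2, _, g3⟩
    rw [h2, Pi.sub_apply, WithLp.ofLp_sub, h3, hh, hC]
    simp only [sub_vecMul, vecMul_vecMul, g1, ← g3, Matrix.mul_assoc, g2, g4, Matrix.mul_one,
      vecMul_one]
  have hspec (f : ℝ → Fin T → ℂ) : IsSpectralCharacteristic P ζ (fun t => F t + G t) O f Y ↔
      f =ᵐ[circleMeasure] h := by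
    rw [isSpectralCharacteristic_iff hSm hDm hS hSS hSD hee hxO hxθ hxY, ← ae_circleProb]
    refine ⟨fun hf => ?_, fun hf => ?_⟩
    · filter_upwards [hf, hθh, hSD] with t h1 h2 h3
      rw [← vecMul_one (f t), ← vecMul_one (h t), ← h3, ← vecMul_vecMul, ← vecMul_vecMul, ← h1, h2]
    · filter_upwards [hf, hθh] with t h1 h2
      rw [h2, h1]
  -- the error
  have hhm (p : Fin T) : AEStronglyMeasurable (fun t => h t p) circleProb := by
    have h1 : AEStronglyMeasurable (fun t => (WithLp.ofLp (θ t) ᵥ* D t) p) circleProb := by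
      simp only [vecMul, dotProduct]
      exact Finset.aestronglyMeasurable_fun_sum _ fun q _ =>
        (sqIntegrable_coeFn θ q).1.mul (hDm q p)
    refine h1.congr ?_
    filter_upwards [hθh, hSD] with t h2 h3
    rw [h2, vecMul_vecMul, h3, vecMul_one]
  have hθφ : inner ℂ θ φ = 0 := hφV θ hθV
  have hΓθφ : Γ = θ + φ := by rw [hφdef, add_sub_cancel]
  have hΓθ : (inner ℂ Γ θ).re = ‖θ‖ ^ 2 := by
    rw [hΓθφ, inner_add_left, ← inner_conj_symm φ, hθφ, map_zero, add_zero,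
      inner_self_eq_norm_sq_to_K]
    norm_cast
  have hΓn : ‖Γ‖ ^ 2 = ‖θ‖ ^ 2 + ‖φ‖ ^ 2 := by
    rw [hΓθφ]
    simpa only [sq] using norm_add_sq_eq_norm_sq_add_norm_sq_of_inner_eq_zero θ φ hθφ
  have hXY : ‖X - Y‖ ^ 2 = ‖X‖ ^ 2 - ‖θ‖ ^ 2 := by
    have h1 : inner ℂ (X - Y) Y = 0 := by
      rw [← inner_conj_symm, inner_eq_zero_of_mem_closure horth hYmem, map_zero]
    have h2 := norm_add_sq_eq_norm_sq_add_norm_sq_of_inner_eq_zero (X - Y) Y h1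
    rw [sub_add_cancel, hYθ] at h2
    linarith
  have herr : weightedNormSq F (fun t => functionalSymbol Z a t - h t) + weightedNormSq G h =
      ENNReal.ofReal (‖X - Y‖ ^ 2) := by
    rw [weightedNormSq_add_eq (fun p q => (hGi p q).1) hF0 hG0 hRR hSS hhm hρc hθh (γ := Γ) ?_,
      hΓθ, hXY, hnormX]
    · congr 1; ring
    · filter_upwards [hθh, hΓc, hall, hF0] with t h1 h2 ⟨_, g1, g2, _⟩ g3
      rw [h1, h2, star_vecMul, conjTranspose_mul, g1, g3.isHermitian, dotProduct_mulVec,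
        vecMul_vecMul, ← Matrix.mul_assoc, g2, Matrix.one_mul, ← dotProduct_mulVec]
  have hrF (t : ℝ) : (functionalSymbol Z a t ᵥ* F t - C t) ᵥ* (F t + G t)⁻¹ = h t := by
    rw [sub_vecMul, vecMul_vecMul]
  have hrG : ∀ᵐ t ∂circleProb, (functionalSymbol Z a t ᵥ* G t + C t) ᵥ* (F t + G t)⁻¹ =
      functionalSymbol Z a t - h t := by
    filter_upwards [hall] with t ⟨_, _, g1, _, g2, g3⟩
    have h1 : (F t + G t) * (F t + G t)⁻¹ = 1 := by
      rw [← g3, ← g2, Matrix.mul_assoc, ← Matrix.mul_assoc (S t) (D t), g1, Matrix.one_mul, g1]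
    have h2 : G t * (F t + G t)⁻¹ = 1 - F t * (F t + G t)⁻¹ := by
      rw [← h1, Matrix.add_mul, add_sub_cancel_left]
    simp only [add_vecMul, vecMul_vecMul, h2, vecMul_sub, vecMul_one, hh]
    abel
  have hrG' : weightedNormSq F (fun t =>
      (functionalSymbol Z a t ᵥ* G t + C t) ᵥ* (F t + G t)⁻¹) =
      weightedNormSq F (fun t => functionalSymbol Z a t - h t) := by
    rw [weightedNormSq_eq_lintegral, weightedNormSq_eq_lintegral]
    exact lintegral_congr_ae (hrG.mono fun t ht => by simp only [ht])
  refine ⟨hXs, fun p q => ?_, fun p q => ?_, fun k => (hRsum k).summable,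
    fun k => (hQsum k).summable, hQQ.summable, c, ((‖φ‖ ^ 2 : ℝ) : ℂ), C, Y,
    isInverseImage_of_mem_closure hKB hedU hφcl hy fun _ _ => rfl,
    fun c' q' h' => h'.eq_of_mem_closure hKB hedU hφcl hy fun _ _ => rfl,
    fun B' hB' => hB'.symm_apply hKB hedU hφcl hy fun _ _ => rfl,
    ⟨fun p => integrable_circleProb.1 (hCi p), fun k p => (inner_charRow_left hS _ _ _).symm,
      fun k hk p => (inner_charRow_left hS _ _ _).symm.trans (hφe k hk p)⟩,
    hopt, huniq, hspec, ?_, ?_⟩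
  · refine integrable_circleProb.1 ?_
    exact (integrable_mul_conjTranspose hFD hD p q).congr (hFW.mono fun t ht => by simp only [ht])
  · refine integrable_circleProb.1 (((hFi p q).sub (hγγi p q)).congr ?_)
    exact hFWG.mono fun t ht => by simp only [ht, Pi.sub_apply, Matrix.sub_apply]
  · rw [meanSquareError_eq, hrG', ← herr]
    simp only [hrF]
  · rw [meanSquareError_eq, hQQ.tsum_eq, hXY, hΓn]
    push_cast
    ring
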